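/- **Setting.** Customers arrive at an $M/G/\infty$ queue at the points $\{\tau_j\}_{j\in\mathbb Z}$ of a homogeneous Poisson process of intensity $\lambda>0$ on $\mathbb R$. Their service times $\{\sigma_j\}_{j\in\mathbb Z}$ are positive, i.i.d. with distribution function $G$, and independent of $\{\tau_j\}$. The stationary queue length is $X(t)=\sum_{j\in\mathbb Z}\mathbf 1(\tau_j\le t,\ \sigma_j>t-\tau_j)$. One observes $X_i=X(i\delta)$, $i=1,\dots,n$, where $\delta>0$ and $T=n\delta$. **Classes.** For $\beta,L,d,K>0$ let $\lfloor\beta\rfloor$ be the largest integer strictly less than $\beta$. Let $\mathscr G_\beta(L,[0,2d],K)$ be the class of distribution functions $G$ of positive random variables such that $G$ is $\lfloor\beta\rfloor$ times continuously differentiable on $[0,2d]$ (one-sidedly at the end points), $|G^{(\lfloor\beta\rfloor)}(x)-G^{(\lfloor\beta\rfloor)}(y)|\le L|x-y|^{\beta-\lfloor\beta\rfloor}$ for all $x,y\in[0,2d]$, and $\mathrm E_G[\sigma^2]\le K$. **Estimator.** For $0\le k\le n-1$ put $\hat\rho_k=\frac1{n-k}\sum_{i=1}^{n-k}X_i$ and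 $\hat R_k=\frac1{n-k}\sum_{i=1}^{n-k}(X_i-\hat\rho_k)(X_{i+k}-\hat\rho_k)$. Given $h>0$ and an integer $\ell\ge1$, let $M=\{k\in\{1,\dots,n\}: k\delta\in[0,2h]\}$, and let $\{a_k(0)\}_{k\in M}$ minimize $\sum_{k\in M}a_k^2$ subject to $\sum_{k\in M}a_k=0$, $\sum_{k\in M}a_k\,k\delta=1$ and $\sum_{k\in M}a_k(k\delta)^j=0$ for $2\le j\le\ell$. Let $\hat\lambda_*=-\sum_{k\in M}a_k(0)\hat R_k$ with the window width $$h=h_*:=\Big[\frac{K(\sqrt K\vee1)}{L^2T}\Big]^{1/(2\beta+2)} .$$ **Theorem.** For every integer $\ell\ge 1$ there is a constant $C=C(\ell)$, depending on $\ell$ only, with the following property. Let $\beta,L,d,K,\lambda,\delta>0$ and $n\in\mathbb N$ be such that $\ell\ge\lfloor\beta\rfloor+1$, $T=n\delta\ge1$, $2h_*<T$ (so that $M\subseteq\{1,\dots,n-1\}$ and the estimator is well defined), and $$K(\sqrt K\vee1)L^{-2}d^{-2\beta-2}\ \le\ T\ \le\ K(\sqrt K\vee1)L^{-2}\Big[\frac{2}{(\ell+2)\delta}\Big]^{2\beta+2}.$$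 Then $$\sup_{G\in\mathscr G_\beta(L,[0,2d],K)}\Big[\mathrm E_{G,\lambda}\big|\hat\lambda_*-\lambda\big|^2\Big]^{1/2}\ \le\ C\,L^{1/(\beta+1)}(\lambda^2+\lambda)^{1/2}\Big[\frac{K(\sqrt K\vee1)}{T}\Big]^{\beta/(2\beta+2)} .$$ -/

import Mathlib

open MeasureTheory ProbabilityTheory

noncomputable section

namespace MGInf

/-- The largest integer strictly less than `β` (for `β > 0`); thus `0` on `(0, 1]`,
`1` on `(1, 2]`, and so on. -/
def strictFloor (β : ℝ) : ℕ := ⌈β⌉₊ - 1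

/-- A service time law: a probability measure on the line carried by `(0, ∞)`.  Its distribution
function `G` is `cdf ν`. -/
structure IsServiceLaw (ν : Measure ℝ) : Prop where
  prob : IsProbabilityMeasure ν
  pos : ν (Set.Iic 0) = 0

/-- The class `ℋ_β(L, I)`: the distribution function `G` is `⌊β⌋` times continuously differentiable
on the closed interval `I` (one-sided derivatives at the end points) and its derivative of order
`⌊β⌋` is Hölder on `I` with exponent `β - ⌊β⌋` and constant `L`. -/
def smoothClass (β L : ℝ) (I : Set ℝ) : Set (Measure ℝ) :=
  {ν | IsServiceLaw ν ∧
    ContDiffOn ℝ (strictFloor β) (cdf ν) I ∧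
    ∀ x ∈ I, ∀ y ∈ I,
      |iteratedDerivWithin (strictFloor β) (cdf ν) I x
        - iteratedDerivWithin (strictFloor β) (cdf ν) I y|
        ≤ L * |x - y| ^ (β - (strictFloor β : ℝ))}

/-- The class `ℳ_p(K)`: `E_G[σ^p] ≤ K`. -/
def momentClass (p K : ℝ) : Set (Measure ℝ) :=
  {ν | IsServiceLaw ν ∧ ∫⁻ x, ENNReal.ofReal (x ^ p) ∂ν ≤ ENNReal.ofReal K}

/-- The class `𝒢_β(L, I, K) = ℋ_β(L, I) ∩ ℳ_2(K)`. -/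
def serviceClass (β L : ℝ) (I : Set ℝ) (K : ℝ) : Set (Measure ℝ) :=
  smoothClass β L I ∩ momentClass 2 K

variable {Ω : Type*}

/-- The number of the points `τ j ω`, `j ∈ ℤ`, that fall in `B`. -/
def pointCount (τ : ℤ → Ω → ℝ) (B : Set ℝ) (ω : Ω) : ℕ∞ := {j : ℤ | τ j ω ∈ B}.encard

/-- The points `τ j`, `j ∈ ℤ`, form a homogeneous Poisson process of intensity `lam` on the real
line: counts in Borel sets of finite length are Poisson with mean `lam` times the length, and
counts in disjoint sets are independent. -/
structure IsPoissonProcess [MeasurableSpace Ω] (P : Measure Ω) (lam : ℝ) (τ : ℤ → Ω → ℝ) :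
    Prop where
  measurable : ∀ j, Measurable (τ j)
  count_law : ∀ B : Set ℝ, MeasurableSet B → volume B < ⊤ → ∀ m : ℕ,
    P {ω | pointCount τ B ω = m} =
      ENNReal.ofReal (Real.exp (-(lam * volume.real B)) * (lam * volume.real B) ^ m
        / (m.factorial : ℝ))
  count_indep : ∀ (r : ℕ) (B : Fin r → Set ℝ), (∀ i, MeasurableSet (B i)) →
    (∀ i, volume (B i) < ⊤) → Pairwise (Function.onFun Disjoint B) →
      iIndepFun (fun i ω => pointCount τ (B i) ω) P

/-- The primitives of the stationary `M/G/∞` queue with arrival rate `lam` and service time law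
`ν`: Poisson arrival epochs `τ j`, i.i.d. service times `σ j` with law `ν`, the two families being
independent of each other. -/
structure IsMGInfinity [MeasurableSpace Ω] (P : Measure Ω) (lam : ℝ) (ν : Measure ℝ)
    (τ σ : ℤ → Ω → ℝ) : Prop where
  arrivals : IsPoissonProcess P lam τ
  service_measurable : ∀ j, Measurable (σ j)
  service_law : ∀ j, P.map (σ j) = ν
  service_indep : iIndepFun σ P
  indep : IndepFun (fun ω j => τ j ω) (fun ω j => σ j ω) P

open Classical in
/-- The queue length `X(t) = ∑_j 1(τ_j ≤ t, σ_j > t - τ_j)`.  When the mean service time is finite,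
almost surely only finitely many terms are nonzero. -/
def queueLength (τ σ : ℤ → Ω → ℝ) (t : ℝ) (ω : Ω) : ℝ :=
  ∑' j : ℤ, if τ j ω ≤ t ∧ t - τ j ω < σ j ω then 1 else 0

/-- `ρ̂_k`, from the observations `x 1, …, x n`; used for `0 ≤ k ≤ n - 1`. -/
def rhoHat (n : ℕ) (x : ℕ → ℝ) (k : ℕ) : ℝ :=
  1 / ((n : ℝ) - k) * ∑ i ∈ Finset.Icc 1 (n - k), x i

/-- The empirical covariance `R̂_k`, from the observations `x 1, …, x n`; used for
`0 ≤ k ≤ n - 1`. -/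
def covHat (n : ℕ) (x : ℕ → ℝ) (k : ℕ) : ℝ :=
  1 / ((n : ℝ) - k) *
    ∑ i ∈ Finset.Icc 1 (n - k), (x i - rhoHat n x k) * (x (i + k) - rhoHat n x k)

open Classical in
/-- The indices `k ∈ {1, …, n}` with `k δ ∈ D`. -/
def gridIndices (n : ℕ) (δ : ℝ) (D : Set ℝ) : Finset ℕ :=
  (Finset.Icc 1 n).filter fun k => (k : ℝ) * δ ∈ D

/-- The constraints of the optimization problem at the point `x` (here `0 ^ 0 = 1`). -/
def IsFeasible (M : Finset ℕ) (δ : ℝ) (ℓ : ℕ) (x : ℝ) (a : ℕ → ℝ) : Prop :=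
  ∑ k ∈ M, a k = 0 ∧
    ∀ j ∈ Finset.Icc 1 ℓ, ∑ k ∈ M, a k * ((k : ℝ) * δ) ^ j = (j : ℝ) * x ^ (j - 1)

/-- `a` solves the problem: minimize `∑_{k ∈ M} a_k²` subject to the constraints. -/
def IsOptimal (M : Finset ℕ) (δ : ℝ) (ℓ : ℕ) (x : ℝ) (a : ℕ → ℝ) : Prop :=
  IsFeasible M δ ℓ x a ∧
    ∀ b : ℕ → ℝ, IsFeasible M δ ℓ x b → ∑ k ∈ M, a k ^ 2 ≤ ∑ k ∈ M, b k ^ 2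

/-- The weights `a_k(x)`, `k ∈ M`: the solution of the optimization problem.  The values on `M` are
unique by strict convexity, and only these are used. -/
def weights (M : Finset ℕ) (δ : ℝ) (ℓ : ℕ) (x : ℝ) : ℕ → ℝ :=
  Classical.epsilon (IsOptimal M δ ℓ x)

/-- The arrival rate estimator `λ̂ = -∑_{k ∈ M_{D_0}} a_k(0) R̂_k`, `D_0 = [0, 2h]`, as a function of
the observations `x 1, …, x n`. -/
def rateEstimator (n : ℕ) (δ : ℝ) (ℓ : ℕ) (h : ℝ) (x : ℕ → ℝ) : ℝ :=
  -∑ k ∈ gridIndices n δ (Set.Icc 0 (2 * h)),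
    weights (gridIndices n δ (Set.Icc 0 (2 * h))) δ ℓ 0 k * covHat n x k

/-- `K (√K ∨ 1)`. -/
def kappaK (K : ℝ) : ℝ := K * max (Real.sqrt K) 1

/-- The window width `h_* = [K (√K ∨ 1) / (L² T)]^{1/(2β+2)}`. -/
def hStar (β L K T : ℝ) : ℝ := (kappaK K / (L ^ 2 * T)) ^ (1 / (2 * β + 2))

end MGInf

end

/-! The pairs (τ_j, σ_j) form a Poisson process in the plane with intensity λ·(Lebesgue ⊗ ν), and
X(t) is its mass on the set of customers present at time t. Hence Cov(X(s), X(t)) = λ H(|t - s|)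
with H(t) = E(σ - t)⁺ = `excess ν t`. Since H(t) = H(0) - t + ∫₀ᵗ G and G(0) = 0, the slope of H at
0 is -1. So λ is minus the slope at 0 of the covariance function, and the weights a_k form a
differentiation rule at 0 that is exact on polynomials of degree ≤ ℓ. Below, κ = K(√K ∨ 1), h = h_*
and ε = L h^β.

Bias. Taylor expansion of G makes H a polynomial of degree ⌊β⌋ + 1 ≤ ℓ up to an error L t^(β+1), so
the bias is at most λ L (2h)^(β+1) Σ|a_k| (`abs_sum_mul_excess_add_one_le`). Comparing the minimal
ℓ² norm with that of explicit feasible weights gives Σ|a_k| ≤ C/h (`exists_sum_abs_weights_le`). The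
bias is thus of order λε.

Stochastic error. The exponential formula yields the moment generating function of a Poisson
functional, hence its second and fourth central moments (`integral_pointSum_sub_pow`) and, by
polarization, the joint fourth moments of the queue lengths. They bound the mean squared error of
each R̂_k by a multiple of (λH(0) + 1) times the variance of a sample mean
(`integral_covHat_sub_sq_le`). The condition E σ² ≤ K makes that variance of order λK/T, and H(0) ≤
√K, so the mean squared error is of order (λ² + λ)κ/T. Minkowski's inequality over k costs the
factor Σ|a_k| ≤ C/h. The definition of h_* says κ/T = (εh)², so the stochastic error is of order (λ²
+ λ)^(1/2) ε as well.

One obstacle remains: the order λK/T of the variance requires h ≲ √K, which is not assumed. It is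
deduced in `le_mul_sqrt`. If h were much larger than √K, then Σ a_k H(kδ) would be too small to be
near -1, the bias would force ε to be bounded below, and the definition of h_* would contradict T ≥
1 or 2h < T. -/

noncomputable section

namespace MGInf

open scoped ENNReal

variable {Ω : Type*} [MeasurableSpace Ω] {P : Measure Ω} {lam : ℝ} {τ : ℤ → Ω → ℝ}

/-! ### The exponential formula of a Poisson process -/

lemma measurable_pointCount (hτ : ∀ j, Measurable (τ j)) {B : Set ℝ} (hB : MeasurableSet B) :
    Measurable (pointCount τ B) :=
  measurable_encard.comp (measurable_set_iff.2 fun j => (hτ j hB).mem)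

lemma hasSum_poisson_mul_pow (r c : ℝ) :
    HasSum (fun m : ℕ => c ^ m * (Real.exp (-r) * r ^ m / (m.factorial : ℝ)))
      (Real.exp (r * (c - 1))) := by
  have h := (NormedSpace.expSeries_div_hasSum_exp (r * c)).mul_left (Real.exp (-r))
  rw [← congrFun Real.exp_eq_exp_ℝ, ← Real.exp_add] at h
  rw [show r * (c - 1) = -r + r * c by ring]
  have e : (fun m : ℕ => c ^ m * (Real.exp (-r) * r ^ m / (m.factorial : ℝ))) =
      fun m => Real.exp (-r) * ((r * c) ^ m / (m.factorial : ℝ)) := by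
    ext m
    rw [mul_pow]
    ring
  rw [e]
  exact h

lemma tsum_poisson_mul_pow {r c : ℝ} (hr : 0 ≤ r) (hc : 0 ≤ c) :
    ∑' m : ℕ, ENNReal.ofReal (c ^ m) * ENNReal.ofReal (Real.exp (-r) * r ^ m / (m.factorial : ℝ))
      = ENNReal.ofReal (Real.exp (r * (c - 1))) := by
  rw [← (hasSum_poisson_mul_pow r c).tsum_eq, ENNReal.ofReal_tsum_of_nonneg
    (fun m => by positivity) (hasSum_poisson_mul_pow r c).summable]
  congr 1
  ext m
  rw [ENNReal.ofReal_mul (by positivity)]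

namespace IsPoissonProcess

variable [IsProbabilityMeasure P]

/-- The Poisson probabilities of the finite values already sum to 1, so no mass is left for `⊤`. -/
lemma ae_pointCount_ne_top (h : IsPoissonProcess P lam τ) (hlam : 0 ≤ lam) {B : Set ℝ}
    (hB : MeasurableSet B) (hB' : volume B < ⊤) : ∀ᵐ ω ∂P, pointCount τ B ω ≠ ⊤ := by
  have hm := measurable_pointCount h.measurable hB
  have hdisj : Pairwise (Function.onFun Disjoint fun m : ℕ => pointCount τ B ⁻¹' {(m : ℕ∞)}) := by
    intro m k hmk
    refine Disjoint.preimage _ ?_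
    simpa using hmk
  have hsum : P (⋃ m : ℕ, pointCount τ B ⁻¹' {(m : ℕ∞)}) = 1 := by
    rw [measure_iUnion hdisj fun m => hm (measurableSet_singleton _)]
    have := tsum_poisson_mul_pow (r := lam * volume.real B) (c := 1) (by positivity) zero_le_one
    simp only [one_pow, ENNReal.ofReal_one, one_mul, sub_self, mul_zero, Real.exp_zero] at this
    rw [← this]
    exact tsum_congr fun m => h.count_law B hB hB' m
  have hU : (⋃ m : ℕ, pointCount τ B ⁻¹' {(m : ℕ∞)}) ⊆ {ω | pointCount τ B ω ≠ ⊤} := by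
    intro ω hω
    obtain ⟨m, hm⟩ := Set.mem_iUnion.1 hω
    have hm : pointCount τ B ω = m := hm
    simp [hm]
  have hms : MeasurableSet {ω | pointCount τ B ω ≠ ⊤} :=
    hm (measurableSet_singleton ⊤).compl
  refine (prob_compl_eq_zero_iff hms).2 (le_antisymm prob_le_one ?_)
  rw [← hsum]
  exact measure_mono hU

lemma lintegral_comp_pointCount (h : IsPoissonProcess P lam τ) (hlam : 0 ≤ lam) {B : Set ℝ}
    (hB : MeasurableSet B) (hB' : volume B < ⊤) (g : ℕ∞ → ℝ≥0∞) :
    ∫⁻ ω, g (pointCount τ B ω) ∂P = ∑' m : ℕ, g m *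
      ENNReal.ofReal (Real.exp (-(lam * volume.real B)) * (lam * volume.real B) ^ m
        / (m.factorial : ℝ)) := by
  have hm := measurable_pointCount h.measurable hB
  rw [← lintegral_map (f := g) (by fun_prop) hm, lintegral_countable']
  have h0 : P.map (pointCount τ B) {⊤} = 0 := by
    rw [Measure.map_apply hm (measurableSet_singleton _)]
    have := h.ae_pointCount_ne_top hlam hB hB'
    rw [ae_iff] at this
    simp only [not_not] at this
    exact this
  have h1 : ∀ m : ℕ, P.map (pointCount τ B) {(m : ℕ∞)} =
      ENNReal.ofReal (Real.exp (-(lam * volume.real B)) * (lam * volume.real B) ^ m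
        / (m.factorial : ℝ)) := fun m => by
    rw [Measure.map_apply hm (measurableSet_singleton _)]
    exact h.count_law B hB hB' m
  rw [← (Nat.cast_injective (R := ℕ∞)).tsum_eq (f := fun a => g a * P.map (pointCount τ B) {a})]
  · simp_rw [h1]
  · intro a ha
    rcases eq_or_ne a ⊤ with rfl | hne
    · simp [h0] at ha
    · obtain ⟨m, rfl⟩ := ENat.ne_top_iff_exists.1 hne
      exact ⟨m, rfl⟩

end IsPoissonProcess

/-- The partial products of `∏ (1 + u j)` over `ℤ`, exhausted symmetrically. -/
def infProd (u : ℤ → ℝ≥0∞) : ℝ≥0∞ := ⨆ n : ℕ, ∏ j ∈ Finset.Icc (-(n : ℤ)) n, (1 + u j)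

lemma monotone_partialProd (u : ℤ → ℝ≥0∞) :
    Monotone fun n : ℕ => ∏ j ∈ Finset.Icc (-(n : ℤ)) n, (1 + u j) := by
  intro n m hnm
  refine Finset.prod_le_prod_of_subset_of_one_le' ?_ fun _ _ _ => le_self_add
  exact Finset.Icc_subset_Icc (by gcongr) (by exact_mod_cast hnm)

lemma infProd_eq_prod (u : ℤ → ℝ≥0∞) (J : Finset ℤ) (hJ : ∀ j, u j ≠ 0 → j ∈ J) :
    infProd u = ∏ j ∈ J, (1 + u j) := by
  apply le_antisymm
  · refine iSup_le fun n => ?_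
    rw [← Finset.prod_subset (Finset.inter_subset_left (s₂ := J))]
    · exact Finset.prod_le_prod_of_subset_of_one_le' Finset.inter_subset_right
        fun _ _ _ => le_self_add
    · intro j hj hj'
      have : u j = 0 := by
        by_contra h
        exact hj' (Finset.mem_inter.2 ⟨hj, hJ j h⟩)
      simp [this]
  · obtain ⟨n, hn⟩ : ∃ n : ℕ, ∀ j ∈ J, j.natAbs ≤ n :=
      ⟨J.sup Int.natAbs, fun j hj => Finset.le_sup (f := Int.natAbs) hj⟩
    refine le_trans ?_ (le_iSup _ n)
    refine Finset.prod_le_prod_of_subset_of_one_le' ?_ fun _ _ _ => le_self_add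
    intro j hj
    have := hn j hj
    rw [Finset.mem_Icc]
    omega

lemma infProd_iSup (u : ℕ → ℤ → ℝ≥0∞) (hu : Monotone u) :
    infProd (fun j => ⨆ k, u k j) = ⨆ k, infProd (u k) := by
  unfold infProd
  rw [iSup_comm]
  congr 1
  ext n
  have : ∀ F : Finset ℤ, Filter.Tendsto (fun k => ∏ j ∈ F, (1 + u k j)) Filter.atTop
      (nhds (∏ j ∈ F, (1 + ⨆ k, u k j))) := by
    intro F
    induction F using Finset.induction_on with
    | empty => simp
    | insert a F ha ih =>
      simp_rw [Finset.prod_insert ha]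
      refine ENNReal.Tendsto.mul ?_ (Or.inl (by simp)) ih (Or.inl ?_)
      · exact tendsto_const_nhds.add (tendsto_atTop_iSup fun _ _ h => hu h a)
      · refine (Finset.prod_ne_zero_iff.2 fun j _ => by simp)
  refine tendsto_nhds_unique (this _) (tendsto_atTop_iSup fun a b hab => ?_)
  exact Finset.prod_le_prod' fun j _ => by gcongr; exact hu hab j

/-- Grouping the points by the value of `ψ` turns the product into powers whose exponents are counts
of disjoint level sets, which are independent. The value 0 only gives factors 1; it has to be
dropped, because its level set has infinite length in the application. -/
lemma infProd_simpleFunc (ψ : SimpleFunc ℝ ℝ≥0∞) {t : ℤ → ℝ}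
    (hfin : ∀ c ∈ ψ.range, c ≠ 0 → {j | t j ∈ ψ ⁻¹' {c}}.encard ≠ ⊤) :
    infProd (fun j => ψ (t j)) =
      ∏ c ∈ ψ.range.filter (· ≠ 0), (1 + c) ^ ({j | t j ∈ ψ ⁻¹' {c}}.encard).toNat := by
  have hJfin : {j | ψ (t j) ≠ 0}.Finite := by
    have : {j | ψ (t j) ≠ 0} ⊆ ⋃ c ∈ ψ.range.filter (· ≠ 0), {j | t j ∈ ψ ⁻¹' {c}} := by
      intro j hj
      simp only [Set.mem_iUnion]
      exact ⟨ψ (t j), by simpa using hj, rfl⟩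
    refine Set.Finite.subset (Set.Finite.biUnion (Finset.finite_toSet _) fun c hc => ?_) this
    have hc := Finset.mem_filter.1 hc
    exact Set.encard_ne_top_iff.1 (hfin c hc.1 hc.2)
  rw [infProd_eq_prod _ hJfin.toFinset fun j hj => by simpa using hj,
    ← Finset.prod_fiberwise_of_maps_to (t := ψ.range.filter (· ≠ 0)) (g := fun j => ψ (t j))]
  · refine Finset.prod_congr rfl fun c hc => ?_
    have hc := Finset.mem_filter.1 hc
    rw [Finset.prod_congr rfl (g := fun _ => 1 + c) fun j hj => by
      rw [(Finset.mem_filter.1 hj).2], Finset.prod_const]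
    congr 1
    rw [← Set.ncard_def, ← Set.ncard_coe_finset]
    congr 1
    ext j
    simp only [Finset.coe_filter, Set.Finite.mem_toFinset, Set.mem_ofPred_eq, Set.mem_preimage,
      Set.mem_singleton_iff]
    constructor
    · exact fun h => h.2
    · exact fun h => ⟨h ▸ hc.2, h⟩
  · intro j hj
    simpa using hj

lemma measurable_infProd {u : Ω → ℤ → ℝ≥0∞} (hu : ∀ j, Measurable fun ω => u ω j) :
    Measurable fun ω => infProd (u ω) := by
  unfold infProd
  refine Measurable.iSup fun n => ?_
  refine Finset.measurable_prod _ fun j _ => ?_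
  exact measurable_const.add (hu j)

namespace IsPoissonProcess

variable [IsProbabilityMeasure P]

lemma lintegral_pow_pointCount (h : IsPoissonProcess P lam τ) (hlam : 0 ≤ lam) {B : Set ℝ}
    (hB : MeasurableSet B) (hB' : volume B < ⊤) {c : ℝ≥0∞} (hc : c ≠ ⊤) :
    ∫⁻ ω, (1 + c) ^ (pointCount τ B ω).toNat ∂P
      = ENNReal.ofReal (Real.exp (lam * (c * volume B).toReal)) := by
  rw [h.lintegral_comp_pointCount hlam hB hB' (fun a => (1 + c) ^ a.toNat)]
  have := tsum_poisson_mul_pow (r := lam * volume.real B) (c := 1 + c.toReal) (by positivity)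
    (by positivity)
  rw [ENNReal.toReal_mul]
  convert! this using 2
  · ext m
    rw [ENNReal.ofReal_pow (by positivity), ENNReal.ofReal_add zero_le_one (by positivity),
      ENNReal.ofReal_toReal hc]
    simp
  · rw [Measure.real]
    congr 1
    ring

lemma lintegral_infProd_simpleFunc (h : IsPoissonProcess P lam τ) (hlam : 0 ≤ lam)
    (ψ : SimpleFunc ℝ ℝ≥0∞) (hψ : ∀ x, ψ x ≠ ⊤) (hint : ψ.lintegral volume ≠ ⊤) :
    ∫⁻ ω, infProd (fun j => ψ (τ j ω)) ∂P
      = ENNReal.ofReal (Real.exp (lam * (ψ.lintegral volume).toReal)) := by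
  set S := ψ.range.filter (· ≠ 0) with hS
  have hvol : ∀ c ∈ S, volume (ψ ⁻¹' {c}) < ⊤ := fun c hc =>
    (SimpleFunc.FinMeasSupp.of_lintegral_ne_top hint).meas_preimage_singleton_ne_zero
      (Finset.mem_filter.1 hc).2
  have hne : ∀ c ∈ S, c ≠ ⊤ := fun c hc => by
    obtain ⟨x, rfl⟩ := SimpleFunc.mem_range.1 (Finset.mem_filter.1 hc).1
    exact hψ x
  have hms : ∀ c, MeasurableSet (ψ ⁻¹' {c}) := fun c => ψ.measurableSet_preimage _
  have hae : ∀ᵐ ω ∂P, infProd (fun j => ψ (τ j ω)) =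
      ∏ c : S, (1 + (c : ℝ≥0∞)) ^ (pointCount τ (ψ ⁻¹' {(c : ℝ≥0∞)}) ω).toNat := by
    have : ∀ᵐ ω ∂P, ∀ c : S, pointCount τ (ψ ⁻¹' {(c : ℝ≥0∞)}) ω ≠ ⊤ :=
      ae_all_iff.2 fun c => h.ae_pointCount_ne_top hlam (hms c) (hvol c c.2)
    filter_upwards [this] with ω hω
    rw [infProd_simpleFunc ψ fun c hc hc0 => hω ⟨c, Finset.mem_filter.2 ⟨hc, hc0⟩⟩,
      ← Finset.prod_coe_sort]
    rfl
  rw [lintegral_congr_ae hae]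
  let e := S.equivFin
  have hind : iIndepFun (fun c : S => pointCount τ (ψ ⁻¹' {(c : ℝ≥0∞)})) P := by
    have := h.count_indep S.card (fun i => ψ ⁻¹' {((e.symm i : S) : ℝ≥0∞)}) (fun i => hms _)
      (fun i => hvol _ (e.symm i).2) (by
        intro i j hij
        refine Disjoint.preimage _ ?_
        rw [Set.disjoint_singleton]
        exact fun hh => hij (e.symm.injective (Subtype.ext hh)))
    have := this.precomp e.injective
    simpa [Function.comp_def] using this
  rw [lintegral_prod_eq_prod_lintegral_of_indepFun Finset.univ
    (fun (c : S) ω => (1 + (c : ℝ≥0∞)) ^ (pointCount τ (ψ ⁻¹' {(c : ℝ≥0∞)}) ω).toNat)]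
  · rw [Finset.prod_congr rfl fun (c : S) _ =>
      h.lintegral_pow_pointCount hlam (hms c) (hvol c c.2) (hne c c.2),
      ← ENNReal.ofReal_prod_of_nonneg fun _ _ => by positivity, ← Real.exp_sum, ← Finset.mul_sum,
      ← ENNReal.toReal_sum fun (c : S) _ => ENNReal.mul_ne_top (hne c c.2) (hvol c c.2).ne]
    congr 4
    rw [SimpleFunc.lintegral, Finset.sum_coe_sort S (fun c => c * volume (ψ ⁻¹' {c})), hS,
      Finset.sum_filter_of_ne]
    intro c _ hc h0
    simp [h0] at hc
  · exact hind.comp (fun (c : S) (a : ℕ∞) => (1 + (c : ℝ≥0∞)) ^ a.toNat) fun _ => by fun_prop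
  · intro c
    exact (Measurable.of_discrete (f := fun a : ℕ∞ => (1 + (c : ℝ≥0∞)) ^ a.toNat)).comp
      (measurable_pointCount h.measurable (hms c))

/-- The exponential formula of a Poisson process. -/
lemma lintegral_infProd (h : IsPoissonProcess P lam τ) (hlam : 0 ≤ lam) {ψ : ℝ → ℝ≥0∞}
    (hψ : Measurable ψ) (hint : ∫⁻ x, ψ x ≠ ⊤) :
    ∫⁻ ω, infProd (fun j => ψ (τ j ω)) ∂P
      = ENNReal.ofReal (Real.exp (lam * (∫⁻ x, ψ x).toReal)) := by
  have hle : ∀ k, (SimpleFunc.eapprox ψ k).lintegral volume ≤ ∫⁻ x, ψ x := fun k => by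
    rw [lintegral_eq_iSup_eapprox_lintegral hψ]
    exact le_iSup (fun k => (SimpleFunc.eapprox ψ k).lintegral volume) k
  -- Both sides of the formula are continuous along increasing sequences, so the case of simple
  -- functions suffices.
  have h1 : ∀ ω, infProd (fun j => ψ (τ j ω)) =
      ⨆ k, infProd (fun j => SimpleFunc.eapprox ψ k (τ j ω)) := fun ω => by
    rw [← infProd_iSup]
    · simp_rw [SimpleFunc.iSup_eapprox_apply hψ]
    · intro a b hab j
      exact SimpleFunc.monotone_eapprox ψ hab _
  have hmono : Monotone fun k ω => infProd (fun j => SimpleFunc.eapprox ψ k (τ j ω)) := by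
    intro a b hab ω
    refine iSup_mono fun n => Finset.prod_le_prod' fun j _ => ?_
    gcongr
    exact SimpleFunc.monotone_eapprox ψ hab _
  simp_rw [h1]
  have hmeas : ∀ k, Measurable fun ω => infProd (fun j => SimpleFunc.eapprox ψ k (τ j ω)) :=
    fun k => measurable_infProd fun j =>
      (SimpleFunc.eapprox ψ k).measurable.comp (h.measurable j)
  rw [lintegral_iSup hmeas hmono]
  have h2 : ∀ k, ∫⁻ ω, infProd (fun j => SimpleFunc.eapprox ψ k (τ j ω)) ∂P
      = ENNReal.ofReal (Real.exp (lam * ((SimpleFunc.eapprox ψ k).lintegral volume).toReal)) :=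
    fun k => h.lintegral_infProd_simpleFunc hlam _ (fun x => (SimpleFunc.eapprox_lt_top ψ k x).ne)
      (ne_top_of_le_ne_top hint (hle k))
  simp_rw [h2]
  refine tendsto_nhds_unique (tendsto_atTop_iSup ?_) ?_ (f := fun k => ENNReal.ofReal
    (Real.exp (lam * ((SimpleFunc.eapprox ψ k).lintegral volume).toReal)))
  · intro a b hab
    refine ENNReal.ofReal_le_ofReal (Real.exp_le_exp.2 (mul_le_mul_of_nonneg_left ?_ hlam))
    refine ENNReal.toReal_mono (ne_top_of_le_ne_top hint (hle b)) ?_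
    exact SimpleFunc.lintegral_mono (SimpleFunc.monotone_eapprox ψ hab) le_rfl
  · refine ENNReal.tendsto_ofReal ((Real.continuous_exp.tendsto _).comp (Filter.Tendsto.const_mul _
      ((ENNReal.tendsto_toReal hint).comp ?_)))
    rw [lintegral_eq_iSup_eapprox_lintegral hψ]
    exact tendsto_atTop_iSup fun a b hab =>
      SimpleFunc.lintegral_mono (SimpleFunc.monotone_eapprox ψ hab) le_rfl

end IsPoissonProcess

end MGInf

end

/-! ### The marked Poisson process and the moments of its linear functionals -/

noncomputable section

namespace MGInf

open scoped ENNReal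

variable {Ω : Type*} [MeasurableSpace Ω] {P : Measure Ω} {lam : ℝ} {ν : Measure ℝ}
  {τ σ : ℤ → Ω → ℝ}

namespace IsMGInfinity

lemma measurable_mark (h : IsMGInfinity P lam ν τ σ) (j : ℤ) :
    Measurable fun ω => (τ j ω, σ j ω) :=
  (h.arrivals.measurable j).prodMk (h.service_measurable j)

variable [IsProbabilityMeasure P] [IsProbabilityMeasure ν]

/-- Given the arrival epochs, the marks are still i.i.d. with law `ν`, so each factor can be
averaged separately. This reduces the marked exponential formula to the unmarked one for t ↦ ∫ Ψ(t,
s) dν(s). -/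
lemma lintegral_prod_mark (h : IsMGInfinity P lam ν τ σ) {Ψ : ℝ × ℝ → ℝ≥0∞} (hΨ : Measurable Ψ)
    (F : Finset ℤ) :
    ∫⁻ ω, ∏ j ∈ F, (1 + Ψ (τ j ω, σ j ω)) ∂P
      = ∫⁻ ω, ∏ j ∈ F, (1 + ∫⁻ s, Ψ (τ j ω, s) ∂ν) ∂P := by
  have hτ : Measurable fun ω j => τ j ω := measurable_pi_iff.2 h.arrivals.measurable
  have hσ : Measurable fun ω j => σ j ω := measurable_pi_iff.2 h.service_measurable
  let g : (ℤ → ℝ) × (ℤ → ℝ) → ℝ≥0∞ := fun p => ∏ j ∈ F, (1 + Ψ (p.1 j, p.2 j))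
  have hg : Measurable g := by
    refine Finset.measurable_prod _ fun j _ => measurable_const.add (hΨ.comp ?_)
    fun_prop
  have h1 : ∫⁻ ω, ∏ j ∈ F, (1 + Ψ (τ j ω, σ j ω)) ∂P = ∫⁻ ω, ∫⁻ ω', g (fun j => τ j ω,
      fun j => σ j ω') ∂P ∂P := by
    have hmap := (indepFun_iff_map_prod_eq_prod_map_map hτ.aemeasurable hσ.aemeasurable).1 h.indep
    have := lintegral_map (μ := P) hg (hτ.prodMk hσ)
    rw [← this, hmap, lintegral_prod _ hg.aemeasurable, lintegral_map ?_ hτ]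
    · refine lintegral_congr fun ω => ?_
      rw [lintegral_map (by fun_prop) hσ]
    · exact hg.lintegral_prod_right'
  rw [h1]
  refine lintegral_congr fun ω => ?_
  have hmeas : ∀ j, Measurable fun s => 1 + Ψ (τ j ω, s) := fun j =>
    measurable_const.add (hΨ.comp (by fun_prop))
  have hind : iIndepFun (fun (j : F) ω' => 1 + Ψ (τ j ω, σ j ω')) P :=
    (h.service_indep.precomp (Subtype.val_injective (p := (· ∈ F)))).comp
      (fun (j : F) s => 1 + Ψ (τ j ω, s)) fun j => hmeas j
  have h2 := lintegral_prod_eq_prod_lintegral_of_indepFun Finset.univ _ hind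
    fun j => (hmeas j).comp (h.service_measurable j)
  simp only [g]
  have h3 : ∀ j : ℤ, ∫⁻ ω', (1 + Ψ (τ j ω, σ j ω')) ∂P = 1 + ∫⁻ s, Ψ (τ j ω, s) ∂ν := by
    intro j
    rw [← lintegral_map (f := fun s => 1 + Ψ (τ j ω, s)) (hmeas j) (h.service_measurable j),
      h.service_law j, lintegral_add_left measurable_const]
    simp
  simp_rw [h3] at h2
  rw [Finset.prod_coe_sort F fun j => 1 + ∫⁻ s, Ψ (τ j ω, s) ∂ν] at h2
  rw [← h2]
  refine lintegral_congr fun ω' => ?_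
  rw [Finset.prod_coe_sort F fun j => 1 + Ψ (τ j ω, σ j ω')]

/-- The exponential formula of the marked Poisson process. -/
lemma lintegral_infProd (h : IsMGInfinity P lam ν τ σ) (hlam : 0 ≤ lam) {Ψ : ℝ × ℝ → ℝ≥0∞}
    (hΨ : Measurable Ψ) (hint : ∫⁻ p, Ψ p ∂(volume.prod ν) ≠ ⊤) :
    ∫⁻ ω, infProd (fun j => Ψ (τ j ω, σ j ω)) ∂P
      = ENNReal.ofReal (Real.exp (lam * (∫⁻ p, Ψ p ∂(volume.prod ν)).toReal)) := by
  have hψ : Measurable fun t => ∫⁻ s, Ψ (t, s) ∂ν := hΨ.lintegral_prod_right'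
  rw [lintegral_prod _ hΨ.aemeasurable] at hint ⊢
  rw [← h.arrivals.lintegral_infProd hlam hψ hint]
  unfold infProd
  rw [lintegral_iSup, lintegral_iSup]
  · simp_rw [h.lintegral_prod_mark hΨ]
  · intro n
    exact Finset.measurable_prod _ fun j _ =>
      measurable_const.add (hψ.comp (h.arrivals.measurable j))
  · exact fun a b hab ω => monotone_partialProd _ hab
  · intro n
    exact Finset.measurable_prod _ fun j _ => measurable_const.add (hΨ.comp (h.measurable_mark j))
  · exact fun a b hab ω => monotone_partialProd _ hab

end IsMGInfinity

/-- With factors 1 + (exp(s x_j) - 1) the partial products are exponentials of partial sums.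
Finiteness of the product bounds these sums through y + 1 ≤ exp y, so almost sure summability comes
with the formula. -/
lemma summable_and_infProd_exp_eq {x : ℤ → ℝ} (hx : ∀ j, 0 ≤ x j) {s : ℝ} (hs : 0 < s)
    (h : infProd (fun j => ENNReal.ofReal (Real.exp (s * x j) - 1)) ≠ ⊤) : Summable x ∧
      infProd (fun j => ENNReal.ofReal (Real.exp (s * x j) - 1))
        = ENNReal.ofReal (Real.exp (s * ∑' j, x j)) := by
  have hF : ∀ F : Finset ℤ, ∏ j ∈ F, (1 + ENNReal.ofReal (Real.exp (s * x j) - 1))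
      = ENNReal.ofReal (Real.exp (s * ∑ j ∈ F, x j)) := by
    intro F
    rw [Finset.mul_sum, Real.exp_sum, ENNReal.ofReal_prod_of_nonneg fun _ _ => by positivity]
    refine Finset.prod_congr rfl fun j _ => ?_
    rw [← ENNReal.ofReal_one, ← ENNReal.ofReal_add zero_le_one]
    · simp
    · have := Real.one_le_exp (mul_nonneg hs.le (hx j))
      linarith
  have hT : Filter.Tendsto (fun n : ℕ => Finset.Icc (-(n : ℤ)) n) Filter.atTop Filter.atTop :=
    Finset.tendsto_Icc_neg
  have hbdd : ∀ n : ℕ, ∑ j ∈ Finset.Icc (-(n : ℤ)) n, x j ≤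
      (infProd (fun j => ENNReal.ofReal (Real.exp (s * x j) - 1))).toReal / s := by
    intro n
    have h1 := le_iSup (fun n : ℕ => ∏ j ∈ Finset.Icc (-(n : ℤ)) n,
      (1 + ENNReal.ofReal (Real.exp (s * x j) - 1))) n
    simp only [hF] at h1
    have h2 := (ENNReal.ofReal_le_iff_le_toReal h).1 (le_trans h1 (by simp only [infProd, hF]; rfl))
    have h3 := Real.add_one_le_exp (s * ∑ j ∈ Finset.Icc (-(n : ℤ)) n, x j)
    rw [le_div_iff₀ hs]
    linarith
  have hsum : Summable x := by
    refine summable_of_sum_le hx (c := (infProd (fun j => ENNReal.ofReal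
      (Real.exp (s * x j) - 1))).toReal / s) fun F => ?_
    obtain ⟨n, hn⟩ := (hT.eventually (Filter.eventually_ge_atTop F)).exists
    exact (Finset.sum_le_sum_of_subset_of_nonneg hn fun _ _ _ => hx _).trans (hbdd n)
  refine ⟨hsum, ?_⟩
  refine tendsto_nhds_unique (tendsto_atTop_iSup (monotone_partialProd _)) ?_
  simp_rw [hF]
  refine ENNReal.tendsto_ofReal ((Real.continuous_exp.tendsto _).comp (Filter.Tendsto.const_mul _ ?_))
  exact hsum.hasSum.comp hT

/-- The value at `f` of the marked point configuration. -/
def pointSum {Ω : Type*} (τ σ : ℤ → Ω → ℝ) (f : ℝ × ℝ → ℝ) (ω : Ω) : ℝ :=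
  ∑' j : ℤ, f (τ j ω, σ j ω)

lemma pointSum_nonneg {Ω : Type*} {τ σ : ℤ → Ω → ℝ} {f : ℝ × ℝ → ℝ} (hf : ∀ p, 0 ≤ f p) (ω : Ω) :
    0 ≤ pointSum τ σ f ω :=
  tsum_nonneg fun _ => hf _

/-- Bounded nonnegative functions with support of finite measure. -/
structure IsBoundedFinite (μ : Measure (ℝ × ℝ)) (f : ℝ × ℝ → ℝ) : Prop where
  measurable : Measurable f
  nonneg : ∀ p, 0 ≤ f p
  bounded : ∃ B, ∀ p, f p ≤ B
  support : μ (Function.support f) < ⊤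

namespace IsBoundedFinite

variable {μ : Measure (ℝ × ℝ)} {f : ℝ × ℝ → ℝ}

lemma isFiniteMeasure (hf : IsBoundedFinite μ f) :
    IsFiniteMeasure (μ.restrict (Function.support f)) :=
  ⟨by simpa using hf.support⟩

lemma integrable_exp (hf : IsBoundedFinite μ f) (s : ℝ) :
    Integrable (fun p => Real.exp (s * f p)) (μ.restrict (Function.support f)) := by
  have := hf.isFiniteMeasure
  obtain ⟨B, hB⟩ := hf.bounded
  refine Integrable.of_bound (C := Real.exp (|s| * B)) ?_ (Filter.Eventually.of_forall fun p => ?_)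
  · exact (Real.measurable_exp.comp (hf.measurable.const_mul s)).aestronglyMeasurable
  · rw [Real.norm_eq_abs, Real.abs_exp]
    refine Real.exp_le_exp.2 ?_
    calc s * f p ≤ |s| * f p := mul_le_mul_of_nonneg_right (le_abs_self s) (hf.nonneg p)
      _ ≤ |s| * B := mul_le_mul_of_nonneg_left (hB p) (abs_nonneg s)

/-- On its support `f` sees a finite measure, so exp(sf) - 1 splits into two values of a moment
generating function, the one at 0 being the mass of the support. In this form derivatives in s are
at hand. -/
lemma lintegral_exp_sub_one (hf : IsBoundedFinite μ f) {s : ℝ} (hs : 0 ≤ s) :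
    ∫⁻ p, ENNReal.ofReal (Real.exp (s * f p) - 1) ∂μ = ENNReal.ofReal
      (mgf f (μ.restrict (Function.support f)) s - mgf f (μ.restrict (Function.support f)) 0) := by
  have := hf.isFiniteMeasure
  rw [← setLIntegral_eq_of_support_subset (s := Function.support f),
    ← ofReal_integral_eq_lintegral_ofReal]
  · congr 1
    rw [integral_sub (hf.integrable_exp s) (integrable_const 1)]
    simp [mgf]
  · exact (hf.integrable_exp s).sub (integrable_const 1)
  · refine Filter.Eventually.of_forall fun p => ?_
    have := Real.one_le_exp (mul_nonneg hs (hf.nonneg p))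
    simp only [Pi.zero_apply]
    linarith
  · intro p hp
    rw [Function.mem_support] at hp ⊢
    rintro h0
    simp [h0] at hp

end IsBoundedFinite

namespace IsMGInfinity

lemma measurable_pointSum (h : IsMGInfinity P lam ν τ σ) {f : ℝ × ℝ → ℝ} (hf : Measurable f)
    (hf0 : ∀ p, 0 ≤ f p) : Measurable (pointSum τ σ f) := by
  have : pointSum τ σ f = fun ω => (∑' j : ℤ, ENNReal.ofReal (f (τ j ω, σ j ω))).toReal := by
    ext ω
    rw [ENNReal.tsum_toReal_eq fun j => ENNReal.ofReal_ne_top]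
    simp_rw [ENNReal.toReal_ofReal (hf0 _)]
    rfl
  rw [this]
  exact (Measurable.tsum fun j =>
    (hf.comp (h.measurable_mark j)).ennreal_ofReal).ennreal_toReal

variable [IsProbabilityMeasure P] [IsProbabilityMeasure ν] {f : ℝ × ℝ → ℝ}

lemma exp_pointSum (h : IsMGInfinity P lam ν τ σ) (hlam : 0 ≤ lam)
    (hf : IsBoundedFinite (volume.prod ν) f) {s : ℝ} (hs : 0 < s) :
    (∀ᵐ ω ∂P, Summable fun j => f (τ j ω, σ j ω)) ∧
    ∫⁻ ω, ENNReal.ofReal (Real.exp (s * pointSum τ σ f ω)) ∂P = ENNReal.ofReal (Real.exp (lam *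
      (mgf f ((volume.prod ν).restrict (Function.support f)) s -
        mgf f ((volume.prod ν).restrict (Function.support f)) 0))) := by
  have hm : Measurable fun p => ENNReal.ofReal (Real.exp (s * f p) - 1) :=
    ((Real.measurable_exp.comp (hf.measurable.const_mul s)).sub_const 1).ennreal_ofReal
  have h1 := hf.lintegral_exp_sub_one hs.le
  have h2 := h.lintegral_infProd hlam hm (by rw [h1]; exact ENNReal.ofReal_ne_top)
  have hfin := ae_lt_top (μ := P) (measurable_infProd fun j => hm.comp (h.measurable_mark j))
    (by simp only [Function.comp_def]; rw [h2]; exact ENNReal.ofReal_ne_top)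
  have hsum : ∀ᵐ ω ∂P, Summable (fun j => f (τ j ω, σ j ω)) ∧
      infProd (fun j => ENNReal.ofReal (Real.exp (s * f (τ j ω, σ j ω)) - 1))
        = ENNReal.ofReal (Real.exp (s * pointSum τ σ f ω)) := by
    filter_upwards [hfin] with ω hω
    exact summable_and_infProd_exp_eq (fun j => hf.nonneg _) hs hω.ne
  refine ⟨hsum.mono fun ω hω => hω.1, ?_⟩
  rw [← lintegral_congr_ae (hsum.mono fun ω hω => hω.2), h2, h1, ENNReal.toReal_ofReal]
  have := hf.isFiniteMeasure
  rw [sub_nonneg]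
  refine integral_mono (hf.integrable_exp 0) (hf.integrable_exp s) fun p => ?_
  exact Real.exp_le_exp.2 (mul_le_mul_of_nonneg_right hs.le (hf.nonneg p))

lemma integrable_exp_pointSum (h : IsMGInfinity P lam ν τ σ) (hlam : 0 ≤ lam)
    (hf : IsBoundedFinite (volume.prod ν) f) (s : ℝ) :
    Integrable (fun ω => Real.exp (s * pointSum τ σ f ω)) P := by
  have hm := h.measurable_pointSum hf.measurable hf.nonneg
  rcases le_or_gt s 0 with hs | hs
  · refine Integrable.of_bound (C := 1) (by fun_prop) (Filter.Eventually.of_forall fun ω => ?_)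
    rw [Real.norm_eq_abs, Real.abs_exp, Real.exp_le_one_iff]
    exact mul_nonpos_of_nonpos_of_nonneg hs (pointSum_nonneg hf.nonneg ω)
  · refine ⟨by fun_prop, ?_⟩
    rw [hasFiniteIntegral_iff_ofReal (Filter.Eventually.of_forall fun _ => Real.exp_nonneg _),
      (h.exp_pointSum hlam hf hs).2]
    exact ENNReal.ofReal_lt_top

/-- The exponential formula needs exp(sf) - 1 ≥ 0 and so covers only s > 0, whereas moments require
derivatives at 0. Both sides are analytic on the whole line and agree on a set accumulating at 0. -/
lemma mgf_pointSum (h : IsMGInfinity P lam ν τ σ) (hlam : 0 ≤ lam)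
    (hf : IsBoundedFinite (volume.prod ν) f) :
    mgf (pointSum τ σ f) P = fun s => Real.exp (lam *
      (mgf f ((volume.prod ν).restrict (Function.support f)) s -
        mgf f ((volume.prod ν).restrict (Function.support f)) 0)) := by
  have hI := h.integrable_exp_pointSum hlam hf
  have hu : integrableExpSet (pointSum τ σ f) P = Set.univ :=
    Set.eq_univ_of_forall hI
  have hu' : integrableExpSet f ((volume.prod ν).restrict (Function.support f)) = Set.univ :=
    Set.eq_univ_of_forall hf.integrable_exp
  refine AnalyticOnNhd.eq_of_frequently_eq (z₀ := (0 : ℝ)) ?_ ?_ ?_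
  · intro s _
    exact analyticAt_mgf (by simp [hu])
  · intro s _
    have : AnalyticAt ℝ (mgf f ((volume.prod ν).restrict (Function.support f))) s :=
      analyticAt_mgf (by simp [hu'])
    fun_prop
  · have hpos : ∀ s : ℝ, 0 < s → mgf (pointSum τ σ f) P s = Real.exp (lam *
      (mgf f ((volume.prod ν).restrict (Function.support f)) s -
        mgf f ((volume.prod ν).restrict (Function.support f)) 0)) := by
      intro s hs
      have h1 := (h.exp_pointSum hlam hf hs).2
      rw [← ofReal_integral_eq_lintegral_ofReal (hI s)
        (Filter.Eventually.of_forall fun _ => Real.exp_nonneg _)] at h1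
      exact (ENNReal.ofReal_eq_ofReal_iff mgf_nonneg (Real.exp_nonneg _)).1 h1
    have ev : ∀ᶠ s in nhdsWithin (0 : ℝ) (Set.Ioi (0 : ℝ)), mgf (pointSum τ σ f) P s = Real.exp (lam *
      (mgf f ((volume.prod ν).restrict (Function.support f)) s -
        mgf f ((volume.prod ν).restrict (Function.support f)) 0)) :=
      eventually_nhdsWithin_of_forall fun s hs => hpos s hs
    exact ev.frequently.filter_mono (nhdsWithin_mono _ fun s (hs : 0 < s) => hs.ne')

lemma integrableExpSet_pointSum (h : IsMGInfinity P lam ν τ σ) (hlam : 0 ≤ lam)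
    (hf : IsBoundedFinite (volume.prod ν) f) :
    integrableExpSet (pointSum τ σ f) P = Set.univ :=
  Set.eq_univ_of_forall (h.integrable_exp_pointSum hlam hf)

end IsMGInfinity

lemma hasDerivAt_mul_exp {ψ q : ℝ → ℝ} {ψ' q' s : ℝ} (hψ : HasDerivAt ψ ψ' s)
    (hq : HasDerivAt q q' s) :
    HasDerivAt (fun s => q s * Real.exp (ψ s)) ((q' + q s * ψ') * Real.exp (ψ s)) s := by
  convert! hq.mul hψ.exp using 1
  ring

/-- The second and fourth derivatives of `exp ∘ ψ` at a zero of `ψ` and `ψ'`. -/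
lemma iteratedDeriv_exp_comp {ψ ψ₁ ψ₂ ψ₃ ψ₄ : ℝ → ℝ} (h₀ : ∀ s, HasDerivAt ψ (ψ₁ s) s)
    (h₁ : ∀ s, HasDerivAt ψ₁ (ψ₂ s) s) (h₂ : ∀ s, HasDerivAt ψ₂ (ψ₃ s) s)
    (h₃ : ∀ s, HasDerivAt ψ₃ (ψ₄ s) s) (z₀ : ψ 0 = 0) (z₁ : ψ₁ 0 = 0) :
    iteratedDeriv 2 (fun s => Real.exp (ψ s)) 0 = ψ₂ 0 ∧
      iteratedDeriv 4 (fun s => Real.exp (ψ s)) 0 = 3 * ψ₂ 0 ^ 2 + ψ₄ 0 := by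
  have d₁ : deriv (fun s => Real.exp (ψ s)) = fun s => ψ₁ s * Real.exp (ψ s) := by
    ext s
    rw [(h₀ s).exp.deriv, mul_comm]
  have d₂ : deriv (fun s => ψ₁ s * Real.exp (ψ s))
      = fun s => (ψ₂ s + ψ₁ s * ψ₁ s) * Real.exp (ψ s) := by
    ext s
    exact (hasDerivAt_mul_exp (h₀ s) (h₁ s)).deriv
  have d₃ : deriv (fun s => (ψ₂ s + ψ₁ s * ψ₁ s) * Real.exp (ψ s))
      = fun s => ((ψ₃ s + (ψ₂ s * ψ₁ s + ψ₁ s * ψ₂ s)) + (ψ₂ s + ψ₁ s * ψ₁ s) * ψ₁ s)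
        * Real.exp (ψ s) := by
    ext s
    exact (hasDerivAt_mul_exp (h₀ s) ((h₂ s).add ((h₁ s).mul (h₁ s)))).deriv
  have d₄ : deriv (fun s => ((ψ₃ s + (ψ₂ s * ψ₁ s + ψ₁ s * ψ₂ s)) + (ψ₂ s + ψ₁ s * ψ₁ s) * ψ₁ s)
        * Real.exp (ψ s)) 0 = 3 * ψ₂ 0 ^ 2 + ψ₄ 0 := by
    refine (hasDerivAt_mul_exp (h₀ 0) (((h₃ 0).add (((h₂ 0).mul (h₁ 0)).add
      ((h₁ 0).mul (h₂ 0)))).add (((h₂ 0).add ((h₁ 0).mul (h₁ 0))).mul (h₁ 0)))).deriv.trans ?_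
    simp only [z₀, z₁, Real.exp_zero]
    simp [z₁]
    ring
  constructor
  · rw [iteratedDeriv_succ, iteratedDeriv_one, d₁, d₂]
    simp [z₀, z₁]
  · rw [iteratedDeriv_succ, iteratedDeriv_succ, iteratedDeriv_succ, iteratedDeriv_one, d₁, d₂, d₃,
      d₄]

lemma IsBoundedFinite.integral_pow_restrict {μ : Measure (ℝ × ℝ)} {f : ℝ × ℝ → ℝ} {n : ℕ}
    (hn : n ≠ 0) : ∫ p, f p ^ n ∂(μ.restrict (Function.support f)) = ∫ p, f p ^ n ∂μ := by
  refine setIntegral_eq_integral_of_forall_compl_eq_zero fun p hp => ?_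
  rw [Function.notMem_support.1 hp, zero_pow hn]

namespace IsMGInfinity

variable [IsProbabilityMeasure P] [IsProbabilityMeasure ν] {f : ℝ × ℝ → ℝ}

/-- Second and fourth central moments of a Poisson functional. -/
lemma integral_pointSum_sub_pow (h : IsMGInfinity P lam ν τ σ) (hlam : 0 ≤ lam)
    (hf : IsBoundedFinite (volume.prod ν) f) :
    ∫ ω, (pointSum τ σ f ω - lam * ∫ p, f p ∂(volume.prod ν)) ^ 2 ∂P
        = lam * ∫ p, f p ^ 2 ∂(volume.prod ν) ∧
      ∫ ω, (pointSum τ σ f ω - lam * ∫ p, f p ∂(volume.prod ν)) ^ 4 ∂P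
        = 3 * (lam * ∫ p, f p ^ 2 ∂(volume.prod ν)) ^ 2
          + lam * ∫ p, f p ^ 4 ∂(volume.prod ν) := by
  set μ := (volume.prod ν).restrict (Function.support f) with hμ
  set c := lam * ∫ p, f p ∂(volume.prod ν) with hc
  have hu' : ∀ s, s ∈ interior (integrableExpSet f μ) := by
    have : integrableExpSet f μ = Set.univ := Set.eq_univ_of_forall hf.integrable_exp
    simp [this]
  have hm : mgf (fun ω => pointSum τ σ f ω - c) P
      = fun s => Real.exp (lam * (mgf f μ s - mgf f μ 0) - s * c) := by
    ext s
    simp_rw [sub_eq_add_neg (pointSum τ σ f _) c]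
    rw [mgf_add_const, h.mgf_pointSum hlam hf, ← Real.exp_add]
    congr 1
    ring
  have hint : ∀ s, s ∈ interior (integrableExpSet (fun ω => pointSum τ σ f ω - c) P) := by
    have : integrableExpSet (fun ω => pointSum τ σ f ω - c) P = Set.univ := by
      refine Set.eq_univ_of_forall fun s => ?_
      have := (h.integrable_exp_pointSum hlam hf s).mul_const (Real.exp (-(s * c)))
      refine this.congr (Filter.Eventually.of_forall fun ω => ?_)
      simp only [← Real.exp_add]
      congr 1
      ring
    simp [this]
  have hd : ∀ n s, HasDerivAt (iteratedDeriv n (mgf f μ)) (iteratedDeriv (n + 1) (mgf f μ) s) s := by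
    intro n s
    have := hasDerivAt_iteratedDeriv_mgf (hu' s) n
    rwa [← iteratedDeriv_mgf (hu' s) (n + 1)] at this
  have hv : ∀ n, n ≠ 0 → iteratedDeriv n (mgf f μ) 0 = ∫ p, f p ^ n ∂(volume.prod ν) := by
    intro n hn
    rw [iteratedDeriv_mgf_zero (hu' 0), hμ]
    exact IsBoundedFinite.integral_pow_restrict hn
  -- The exponent is the cumulant generating function of the centered sum. Subtracting the mean `c`
  -- makes its first derivative vanish at 0, which leaves only the second and fourth cumulants.
  have key := iteratedDeriv_exp_comp (ψ := fun s => lam * (mgf f μ s - mgf f μ 0) - s * c)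
    (ψ₁ := fun s => lam * iteratedDeriv 1 (mgf f μ) s - c)
    (ψ₂ := fun s => lam * iteratedDeriv 2 (mgf f μ) s)
    (ψ₃ := fun s => lam * iteratedDeriv 3 (mgf f μ) s)
    (ψ₄ := fun s => lam * iteratedDeriv 4 (mgf f μ) s)
    (fun s => by
      have := hd 0 s
      rw [iteratedDeriv_zero] at this
      have h2 := ((this.sub_const (mgf f μ 0)).const_mul lam).sub ((hasDerivAt_id s).mul_const c)
      convert! h2 using 1
      ring)
    (fun s => by simpa using ((hd 1 s).const_mul lam).sub_const c)
    (fun s => (hd 2 s).const_mul lam) (fun s => (hd 3 s).const_mul lam) (by simp)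
    (by
      rw [hv 1 one_ne_zero]
      simp [hc])
  rw [← hm, iteratedDeriv_mgf_zero (hint 0), iteratedDeriv_mgf_zero (hint 0)] at key
  rw [hv 2 two_ne_zero, hv 4 four_ne_zero] at key
  exact key

lemma memLp_pointSum (h : IsMGInfinity P lam ν τ σ) (hlam : 0 ≤ lam)
    (hf : IsBoundedFinite (volume.prod ν) f) (p : NNReal) : MemLp (pointSum τ σ f) p P :=
  memLp_of_mem_interior_integrableExpSet (by simp [h.integrableExpSet_pointSum hlam hf]) p

end IsMGInfinity

end MGInf

end

/-! ### Queue lengths as Poisson functionals: covariances and joint fourth moments -/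

noncomputable section

namespace MGInf

open scoped ENNReal

lemma IsBoundedFinite.integrable_pow {μ : Measure (ℝ × ℝ)} {f : ℝ × ℝ → ℝ}
    (hf : IsBoundedFinite μ f) {n : ℕ} (hn : n ≠ 0) : Integrable (fun p => f p ^ n) μ := by
  have := hf.isFiniteMeasure
  obtain ⟨B, hB⟩ := hf.bounded
  have h1 : Integrable (fun p => f p ^ n) (μ.restrict (Function.support f)) := by
    refine Integrable.of_bound (C := B ^ n) (hf.measurable.pow_const n).aestronglyMeasurable
      (Filter.Eventually.of_forall fun p => ?_)
    rw [norm_pow, Real.norm_eq_abs, abs_of_nonneg (hf.nonneg p)]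
    exact pow_le_pow_left₀ (hf.nonneg p) (hB p) n
  refine IntegrableOn.integrable_of_forall_notMem_eq_zero h1 fun p hp => ?_
  rw [Function.notMem_support.1 hp, zero_pow hn]

/-- The arrival epochs and service times of the customers present at time `t`. -/
def presentSet (t : ℝ) : Set (ℝ × ℝ) := {p | p.1 ≤ t ∧ t - p.1 < p.2}

/-- The indicator function of `presentSet t`. -/
def present (t : ℝ) : ℝ × ℝ → ℝ := (presentSet t).indicator 1

/-- `E (σ - t)⁺`, which is the integrated tail `∫_t^∞ (1 - G)`. -/
def excess (ν : Measure ℝ) (t : ℝ) : ℝ := ∫ s, max (s - t) 0 ∂ν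

lemma measurableSet_presentSet (t : ℝ) : MeasurableSet (presentSet t) :=
  (measurableSet_le measurable_fst measurable_const).inter
    (measurableSet_lt (measurable_const.sub measurable_fst) measurable_snd)

lemma measurable_present (t : ℝ) : Measurable (present t) :=
  measurable_one.indicator (measurableSet_presentSet t)

lemma present_nonneg (t : ℝ) (p : ℝ × ℝ) : 0 ≤ present t p :=
  Set.indicator_nonneg (fun _ _ => zero_le_one) p

lemma present_le_one (t : ℝ) (p : ℝ × ℝ) : present t p ≤ 1 :=
  Set.indicator_le_self' (f := (1 : ℝ × ℝ → ℝ)) (fun _ _ => zero_le_one) p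

lemma queueLength_eq_pointSum {Ω : Type*} (τ σ : ℤ → Ω → ℝ) (t : ℝ) :
    queueLength τ σ t = pointSum τ σ (present t) := by
  ext ω
  refine tsum_congr fun j => ?_
  simp only [present, presentSet, Set.indicator_apply, Set.mem_ofPred_eq, Pi.one_apply]

section Excess

variable {ν : Measure ℝ}

lemma excess_nonneg (t : ℝ) : 0 ≤ excess ν t := integral_nonneg fun _ => le_max_right _ _

lemma integrable_excess [IsFiniteMeasure ν] (hI : Integrable id ν) (t : ℝ) :
    Integrable (fun s => max (s - t) 0) ν :=
  (hI.sub (integrable_const t)).pos_part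

lemma excess_anti [IsFiniteMeasure ν] (hI : Integrable id ν) {t u : ℝ} (h : t ≤ u) :
    excess ν u ≤ excess ν t :=
  integral_mono (integrable_excess hI u) (integrable_excess hI t) fun s =>
    max_le_max (by linarith) le_rfl

/-- For t ≤ u, a customer with service time s is present at both times exactly when it arrives in (u
- s, t], an interval of length (s - (u - t))⁺. -/
lemma prod_presentSet_inter [IsFiniteMeasure ν] (hI : Integrable id ν) (t u : ℝ) :
    (volume.prod ν) (presentSet t ∩ presentSet u) = ENNReal.ofReal (excess ν |t - u|) := by
  wlog h : t ≤ u generalizing t u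
  · rw [Set.inter_comm, this u t (le_of_not_ge h), abs_sub_comm]
  rw [Measure.prod_apply_symm ((measurableSet_presentSet t).inter (measurableSet_presentSet u)),
    excess, ofReal_integral_eq_lintegral_ofReal (integrable_excess hI _)
      (Filter.Eventually.of_forall fun _ => le_max_right _ _)]
  refine lintegral_congr fun s => ?_
  have : (fun x => (x, s)) ⁻¹' (presentSet t ∩ presentSet u) = Set.Ioc (u - s) t := by
    ext x
    simp only [presentSet, Set.mem_preimage, Set.mem_inter_iff, Set.mem_ofPred_eq, Set.mem_Ioc]
    constructor
    · rintro ⟨⟨h1, h2⟩, h3, h4⟩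
      exact ⟨by linarith, h1⟩
    · rintro ⟨h1, h2⟩
      exact ⟨⟨h2, by linarith⟩, by linarith, by linarith⟩
  rw [this, Real.volume_Ioc, abs_sub_comm, abs_of_nonneg (sub_nonneg.2 h)]
  rw [show t - (u - s) = s - (u - t) by ring]
  simp

lemma integrable_present_mul [IsFiniteMeasure ν] (hI : Integrable id ν) (t u : ℝ) :
    Integrable (fun p => present t p * present u p) (volume.prod ν) ∧
      ∫ p, present t p * present u p ∂(volume.prod ν) = excess ν |t - u| := by
  have : (fun p => present t p * present u p) = (presentSet t ∩ presentSet u).indicator 1 := by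
    rw [Set.inter_indicator_one]
    rfl
  have hm := (measurableSet_presentSet t).inter (measurableSet_presentSet u)
  rw [this, integral_indicator_one hm, Measure.real, prod_presentSet_inter hI,
    ENNReal.toReal_ofReal (excess_nonneg _)]
  refine ⟨?_, rfl⟩
  rw [Pi.one_def, integrable_indicator_iff hm]
  refine integrableOn_const (by rw [prod_presentSet_inter hI]; exact ENNReal.ofReal_ne_top)

lemma present_sq (t : ℝ) (p : ℝ × ℝ) : present t p * present t p = present t p := by
  by_cases h : p ∈ presentSet t <;> simp [present, h]

lemma integrable_present [IsFiniteMeasure ν] (hI : Integrable id ν) (t : ℝ) :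
    Integrable (present t) (volume.prod ν) ∧
      ∫ p, present t p ∂(volume.prod ν) = excess ν 0 := by
  have := integrable_present_mul hI t t
  simpa only [present_sq, sub_self, abs_zero] using this

lemma isBoundedFinite_sum [IsFiniteMeasure ν] (hI : Integrable id ν) {ι : Type*} (S : Finset ι)
    {θ : ι → ℝ} (hθ : ∀ i ∈ S, 0 ≤ θ i) (t : ι → ℝ) :
    IsBoundedFinite (volume.prod ν) (fun p => ∑ i ∈ S, θ i * present (t i) p) where
  measurable := Finset.measurable_sum _ fun i _ => (measurable_present (t i)).const_mul _
  nonneg p := Finset.sum_nonneg fun i hi => mul_nonneg (hθ i hi) (present_nonneg _ _)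
  bounded := ⟨∑ i ∈ S, θ i, fun p => Finset.sum_le_sum fun i hi =>
    mul_le_of_le_one_right (hθ i hi) (present_le_one _ _)⟩
  support := by
    have : Function.support (fun p => ∑ i ∈ S, θ i * present (t i) p) ⊆
        ⋃ i ∈ S, presentSet (t i) := by
      intro p hp
      obtain ⟨i, hi, h⟩ := Finset.exists_ne_zero_of_sum_ne_zero hp
      simp only [Set.mem_iUnion]
      refine ⟨i, hi, ?_⟩
      by_contra hn
      exact h (by simp [present, hn])
    refine (measure_mono this).trans_lt ?_
    refine (measure_biUnion_lt_top S.finite_toSet fun i _ => ?_)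
    have := prod_presentSet_inter hI (t i) (t i)
    rw [Set.inter_self] at this
    rw [this]
    exact ENNReal.ofReal_lt_top

lemma isBoundedFinite_present [IsFiniteMeasure ν] (hI : Integrable id ν) (t : ℝ) :
    IsBoundedFinite (volume.prod ν) (present t) := by
  have := isBoundedFinite_sum hI {()} (θ := fun _ => 1) (by simp) (fun _ => t)
  simpa using this

end Excess

variable {Ω : Type*} [MeasurableSpace Ω] {P : Measure Ω} {lam : ℝ} {ν : Measure ℝ}
  {τ σ : ℤ → Ω → ℝ}

/-- The centered queue length. -/
def centered {Ω : Type*} (lam : ℝ) (ν : Measure ℝ) (τ σ : ℤ → Ω → ℝ) (t : ℝ) (ω : Ω) : ℝ :=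
  queueLength τ σ t ω - lam * excess ν 0

namespace IsMGInfinity

lemma measurable_centered (h : IsMGInfinity P lam ν τ σ) (t : ℝ) :
    Measurable (centered lam ν τ σ t) := by
  have := h.measurable_pointSum (measurable_present t) (present_nonneg t)
  rw [← queueLength_eq_pointSum] at this
  exact this.sub_const _

variable [IsProbabilityMeasure P] [IsProbabilityMeasure ν]

/-- The equality is only almost sure: exchanging the finite sum with the sum over customers requires
finitely many customers present. -/
lemma sum_centered_ae_eq (h : IsMGInfinity P lam ν τ σ) (hlam : 0 ≤ lam) (hI : Integrable id ν)
    {ι : Type*} (S : Finset ι) (θ t : ι → ℝ) :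
    (fun ω => ∑ i ∈ S, θ i * centered lam ν τ σ (t i) ω) =ᵐ[P]
      fun ω => pointSum τ σ (fun p => ∑ i ∈ S, θ i * present (t i) p) ω
        - lam * ∫ p, ∑ i ∈ S, θ i * present (t i) p ∂(volume.prod ν) := by
  have hs : ∀ᵐ ω ∂P, ∀ i ∈ S, Summable fun j => present (t i) (τ j ω, σ j ω) :=
    (Finset.eventually_all S).2 fun i _ =>
      (h.exp_pointSum hlam (isBoundedFinite_present hI (t i)) one_pos).1
  have hint : ∫ p, ∑ i ∈ S, θ i * present (t i) p ∂(volume.prod ν) = ∑ i ∈ S, θ i * excess ν 0 := by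
    rw [integral_finsetSum _ fun i _ => (integrable_present hI (t i)).1.const_mul _]
    refine Finset.sum_congr rfl fun i _ => ?_
    rw [integral_const_mul, (integrable_present hI (t i)).2]
  filter_upwards [hs] with ω hω
  rw [hint, pointSum, Summable.tsum_finsetSum fun i hi => (hω i hi).mul_left _, Finset.mul_sum,
    ← Finset.sum_sub_distrib]
  refine Finset.sum_congr rfl fun i hi => ?_
  rw [tsum_mul_left, centered, queueLength_eq_pointSum, pointSum]
  ring

/-- Moments of nonnegative linear combinations of centered queue lengths. -/
lemma integral_sum_centered_pow (h : IsMGInfinity P lam ν τ σ) (hlam : 0 ≤ lam)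
    (hI : Integrable id ν) {ι : Type*} (S : Finset ι) {θ : ι → ℝ} (hθ : ∀ i ∈ S, 0 ≤ θ i)
    (t : ι → ℝ) :
    ∫ ω, (∑ i ∈ S, θ i * centered lam ν τ σ (t i) ω) ^ 2 ∂P
        = lam * ∫ p, (∑ i ∈ S, θ i * present (t i) p) ^ 2 ∂(volume.prod ν) ∧
      ∫ ω, (∑ i ∈ S, θ i * centered lam ν τ σ (t i) ω) ^ 4 ∂P
        = 3 * (lam * ∫ p, (∑ i ∈ S, θ i * present (t i) p) ^ 2 ∂(volume.prod ν)) ^ 2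
          + lam * ∫ p, (∑ i ∈ S, θ i * present (t i) p) ^ 4 ∂(volume.prod ν) := by
  have hae := h.sum_centered_ae_eq hlam hI S θ t
  have key := h.integral_pointSum_sub_pow hlam (isBoundedFinite_sum hI S hθ t)
  refine ⟨?_, ?_⟩
  · rw [← key.1]
    exact integral_congr_ae (hae.mono fun ω hω => by simp only [hω])
  · rw [← key.2]
    exact integral_congr_ae (hae.mono fun ω hω => by simp only [hω])

lemma integrable_sum_centered_pow (h : IsMGInfinity P lam ν τ σ) (hlam : 0 ≤ lam)
    (hI : Integrable id ν) {ι : Type*} (S : Finset ι) {θ : ι → ℝ} (hθ : ∀ i ∈ S, 0 ≤ θ i)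
    (t : ι → ℝ) (n : ℕ) :
    Integrable (fun ω => (∑ i ∈ S, θ i * centered lam ν τ σ (t i) ω) ^ n) P := by
  have hae := h.sum_centered_ae_eq hlam hI S θ t
  have h1 := (h.memLp_pointSum hlam (isBoundedFinite_sum hI S hθ t) n).sub
    (memLp_const (lam * ∫ p, ∑ i ∈ S, θ i * present (t i) p ∂(volume.prod ν)))
  have h2 := (memLp_congr_ae hae).2 h1
  have h3 := h2.integrable_norm_pow'
  refine h3.mono' ?_ ?_
  · exact (h2.aestronglyMeasurable).pow n
  · exact Filter.Eventually.of_forall fun ω => by simp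

lemma integral_present_sum_sq (hI : Integrable id ν) {ι : Type*} (S : Finset ι) (θ t : ι → ℝ) :
    ∫ p, (∑ i ∈ S, θ i * present (t i) p) ^ 2 ∂(volume.prod ν)
      = ∑ i ∈ S, ∑ j ∈ S, θ i * θ j * excess ν |t i - t j| := by
  have : ∀ p, (∑ i ∈ S, θ i * present (t i) p) ^ 2
      = ∑ i ∈ S, ∑ j ∈ S, θ i * θ j * (present (t i) p * present (t j) p) := fun p => by
    rw [sq, Finset.sum_mul_sum]
    exact Finset.sum_congr rfl fun i _ => Finset.sum_congr rfl fun j _ => by ring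
  simp_rw [this]
  have hi : ∀ i j, Integrable (fun p => θ i * θ j * (present (t i) p * present (t j) p))
    (volume.prod ν) := fun i j => (integrable_present_mul hI _ _).1.const_mul _
  rw [integral_finsetSum _ fun i _ => integrable_finsetSum _ fun j _ => hi i j]
  refine Finset.sum_congr rfl fun i _ => ?_
  rw [integral_finsetSum _ fun j _ => hi i j]
  refine Finset.sum_congr rfl fun j _ => ?_
  rw [integral_const_mul, (integrable_present_mul hI _ _).2]

/-- The variance of a linear combination of queue lengths. -/
lemma integral_sum_centered_sq (h : IsMGInfinity P lam ν τ σ) (hlam : 0 ≤ lam)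
    (hI : Integrable id ν) {ι : Type*} (S : Finset ι) {θ : ι → ℝ} (hθ : ∀ i ∈ S, 0 ≤ θ i)
    (t : ι → ℝ) :
    ∫ ω, (∑ i ∈ S, θ i * centered lam ν τ σ (t i) ω) ^ 2 ∂P
      = lam * ∑ i ∈ S, ∑ j ∈ S, θ i * θ j * excess ν |t i - t j| := by
  rw [(h.integral_sum_centered_pow hlam hI S hθ t).1, integral_present_sum_sq hI]

/-- If the coefficients sum to at most 1, the integrand F takes values in [0, 1], so F⁴ ≤ F² and the
fourth cumulant is at most the variance. -/
lemma integral_sum_centered_pow_four_le (h : IsMGInfinity P lam ν τ σ) (hlam : 0 ≤ lam)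
    (hI : Integrable id ν) {ι : Type*} (S : Finset ι) {θ : ι → ℝ} (hθ : ∀ i ∈ S, 0 ≤ θ i)
    (hθ1 : ∑ i ∈ S, θ i ≤ 1) (t : ι → ℝ) :
    ∫ ω, (∑ i ∈ S, θ i * centered lam ν τ σ (t i) ω) ^ 4 ∂P
      ≤ 3 * (∫ ω, (∑ i ∈ S, θ i * centered lam ν τ σ (t i) ω) ^ 2 ∂P) ^ 2
        + ∫ ω, (∑ i ∈ S, θ i * centered lam ν τ σ (t i) ω) ^ 2 ∂P := by
  obtain ⟨h2, h4⟩ := h.integral_sum_centered_pow hlam hI S hθ t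
  rw [h4, h2]
  refine add_le_add le_rfl (mul_le_mul_of_nonneg_left ?_ hlam)
  have h01 : ∀ p, 0 ≤ ∑ i ∈ S, θ i * present (t i) p ∧ ∑ i ∈ S, θ i * present (t i) p ≤ 1 :=
    fun p => ⟨(isBoundedFinite_sum hI S hθ t).nonneg p, le_trans (Finset.sum_le_sum fun i hi =>
      mul_le_of_le_one_right (hθ i hi) (present_le_one _ _)) hθ1⟩
  refine integral_mono_of_nonneg (Filter.Eventually.of_forall fun p => by positivity) ?_
    (Filter.Eventually.of_forall fun p => ?_)
  · exact (isBoundedFinite_sum hI S hθ t).integrable_pow two_ne_zero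
  · exact pow_le_pow_of_le_one (h01 p).1 (h01 p).2 (by norm_num)

end IsMGInfinity

/-- Polarization by inclusion–exclusion over {0,1}⁴. It uses nonnegative coefficients only, as the
moment formulas for sums of centered queue lengths require. -/
lemma sum_neg_one_pow_mul_pow_four (y₀ y₁ y₂ y₃ : ℝ) :
    ∑ q ∈ (Finset.range 2 ×ˢ Finset.range 2) ×ˢ (Finset.range 2 ×ˢ Finset.range 2),
      (-1 : ℝ) ^ (q.1.1 + q.1.2 + q.2.1 + q.2.2) *
        (q.1.1 * y₀ + q.1.2 * y₁ + q.2.1 * y₂ + q.2.2 * y₃) ^ 4 = 24 * (y₀ * y₁ * y₂ * y₃) := by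
  simp only [Finset.sum_product, Finset.sum_range_succ, Finset.sum_range_zero]
  push_cast
  ring

/-- The same alternating sum applied to the squared variance of a 0/1 combination: `e` is the common
variance, the other letters are covariances. The three pairings of the Gaussian fourth moment
survive; the factor 3 in the fourth moment turns 8 into 24. -/
lemma sum_neg_one_pow_mul_quadratic_sq (e ab ac ad bc bd cd : ℝ) :
    ∑ q ∈ (Finset.range 2 ×ˢ Finset.range 2) ×ˢ (Finset.range 2 ×ˢ Finset.range 2),
      (-1 : ℝ) ^ (q.1.1 + q.1.2 + q.2.1 + q.2.2) *
        ((q.1.1 ^ 2 + q.1.2 ^ 2 + q.2.1 ^ 2 + q.2.2 ^ 2) * e + 2 * (q.1.1 * q.1.2 * ab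
          + q.1.1 * q.2.1 * ac + q.1.1 * q.2.2 * ad + q.1.2 * q.2.1 * bc + q.1.2 * q.2.2 * bd
          + q.2.1 * q.2.2 * cd)) ^ 2 = 8 * (ab * cd + ac * bd + ad * bc) := by
  simp only [Finset.sum_product, Finset.sum_range_succ, Finset.sum_range_zero]
  push_cast
  ring

namespace IsMGInfinity

variable [IsProbabilityMeasure P] [IsProbabilityMeasure ν]

lemma integral_centered_mul_four (h : IsMGInfinity P lam ν τ σ) (hlam : 0 ≤ lam)
    (hI : Integrable id ν) (a b c d : ℝ) :
    Integrable (fun ω => centered lam ν τ σ a ω * centered lam ν τ σ b ω * centered lam ν τ σ c ω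
      * centered lam ν τ σ d ω) P ∧
    ∫ ω, centered lam ν τ σ a ω * centered lam ν τ σ b ω * centered lam ν τ σ c ω
        * centered lam ν τ σ d ω ∂P
      = lam ^ 2 * (excess ν |a - b| * excess ν |c - d| + excess ν |a - c| * excess ν |b - d|
          + excess ν |a - d| * excess ν |b - c|)
        + lam * ∫ p, present a p * present b p * present c p * present d p ∂(volume.prod ν) := by
  set I := (Finset.range 2 ×ˢ Finset.range 2) ×ˢ (Finset.range 2 ×ˢ Finset.range 2) with hIdef
  let θ : (ℕ × ℕ) × (ℕ × ℕ) → Fin 4 → ℝ := fun q => ![q.1.1, q.1.2, q.2.1, q.2.2]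
  have hθ : ∀ q, ∀ i ∈ Finset.univ, 0 ≤ θ q i := by
    intro q i _
    fin_cases i <;> simp [θ]
  have hFc : ∀ q : (ℕ × ℕ) × (ℕ × ℕ), ∀ ω, ∑ i, θ q i * centered lam ν τ σ (![a, b, c, d] i) ω
      = q.1.1 * centered lam ν τ σ a ω + q.1.2 * centered lam ν τ σ b ω
        + q.2.1 * centered lam ν τ σ c ω + q.2.2 * centered lam ν τ σ d ω := by
    intro q ω
    simp [θ, Fin.sum_univ_four]
  have hFp : ∀ q : (ℕ × ℕ) × (ℕ × ℕ), ∀ p, ∑ i, θ q i * present (![a, b, c, d] i) p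
      = q.1.1 * present a p + q.1.2 * present b p
        + q.2.1 * present c p + q.2.2 * present d p := by
    intro q p
    simp [θ, Fin.sum_univ_four]
  have hint : ∀ q : (ℕ × ℕ) × (ℕ × ℕ), Integrable (fun ω => (-1 : ℝ) ^ (q.1.1 + q.1.2 + q.2.1
      + q.2.2) * (q.1.1 * centered lam ν τ σ a ω + q.1.2 * centered lam ν τ σ b ω
      + q.2.1 * centered lam ν τ σ c ω + q.2.2 * centered lam ν τ σ d ω) ^ 4) P := by
    intro q
    have := h.integrable_sum_centered_pow hlam hI Finset.univ (hθ q) ![a, b, c, d] 4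
    simp_rw [hFc] at this
    exact this.const_mul _
  have hintg : ∀ q : (ℕ × ℕ) × (ℕ × ℕ), Integrable (fun p => (-1 : ℝ) ^ (q.1.1 + q.1.2 + q.2.1
      + q.2.2) * (q.1.1 * present a p + q.1.2 * present b p
      + q.2.1 * present c p + q.2.2 * present d p) ^ 4) (volume.prod ν) := by
    intro q
    refine Integrable.const_mul ?_ _
    have hb := isBoundedFinite_sum hI Finset.univ (hθ q) ![a, b, c, d]
    simp_rw [hFp] at hb
    exact hb.integrable_pow four_ne_zero
  have hmom : ∀ q : (ℕ × ℕ) × (ℕ × ℕ), ∫ ω, (q.1.1 * centered lam ν τ σ a ω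
      + q.1.2 * centered lam ν τ σ b ω + q.2.1 * centered lam ν τ σ c ω
      + q.2.2 * centered lam ν τ σ d ω) ^ 4 ∂P
      = 3 * (lam * ((q.1.1 ^ 2 + q.1.2 ^ 2 + q.2.1 ^ 2 + q.2.2 ^ 2) * excess ν 0
          + 2 * (q.1.1 * q.1.2 * excess ν |a - b|
          + q.1.1 * q.2.1 * excess ν |a - c| + q.1.1 * q.2.2 * excess ν |a - d|
          + q.1.2 * q.2.1 * excess ν |b - c| + q.1.2 * q.2.2 * excess ν |b - d|
          + q.2.1 * q.2.2 * excess ν |c - d|))) ^ 2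
        + lam * ∫ p, (q.1.1 * present a p + q.1.2 * present b p
      + q.2.1 * present c p + q.2.2 * present d p) ^ 4 ∂(volume.prod ν) := by
    intro q
    have := (h.integral_sum_centered_pow hlam hI Finset.univ (hθ q) ![a, b, c, d]).2
    rw [integral_present_sum_sq hI] at this
    simp_rw [hFc, hFp] at this
    rw [this]
    congr 4
    simp only [Fin.sum_univ_four, θ, Matrix.cons_val, sub_self, abs_zero]
    rw [abs_sub_comm b a, abs_sub_comm c a, abs_sub_comm c b, abs_sub_comm d a, abs_sub_comm d b,
      abs_sub_comm d c]
    ring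
  have hY : ∀ ω, centered lam ν τ σ a ω * centered lam ν τ σ b ω * centered lam ν τ σ c ω
      * centered lam ν τ σ d ω = 24⁻¹ * ∑ q ∈ I, (-1 : ℝ) ^ (q.1.1 + q.1.2 + q.2.1
      + q.2.2) * (q.1.1 * centered lam ν τ σ a ω + q.1.2 * centered lam ν τ σ b ω
      + q.2.1 * centered lam ν τ σ c ω + q.2.2 * centered lam ν τ σ d ω) ^ 4 := fun ω => by
    rw [hIdef, sum_neg_one_pow_mul_pow_four]
    ring
  have hG : ∀ p, present a p * present b p * present c p
      * present d p = 24⁻¹ * ∑ q ∈ I, (-1 : ℝ) ^ (q.1.1 + q.1.2 + q.2.1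
      + q.2.2) * (q.1.1 * present a p + q.1.2 * present b p
      + q.2.1 * present c p + q.2.2 * present d p) ^ 4 := fun p => by
    rw [hIdef, sum_neg_one_pow_mul_pow_four]
    ring
  simp_rw [hY, hG]
  refine ⟨(integrable_finsetSum _ fun q _ => hint q).const_mul _, ?_⟩
  rw [integral_const_mul, integral_const_mul, integral_finsetSum _ fun q _ => hint q,
    integral_finsetSum _ fun q _ => hintg q]
  simp_rw [integral_const_mul, hmom]
  have h8 := sum_neg_one_pow_mul_quadratic_sq (excess ν 0) (excess ν |a - b|) (excess ν |a - c|)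
    (excess ν |a - d|) (excess ν |b - c|) (excess ν |b - d|) (excess ν |c - d|)
  rw [← hIdef] at h8
  have h9 : excess ν |a - b| * excess ν |c - d| + excess ν |a - c| * excess ν |b - d|
          + excess ν |a - d| * excess ν |b - c| = 8⁻¹ * (8 * (excess ν |a - b| * excess ν |c - d|
          + excess ν |a - c| * excess ν |b - d| + excess ν |a - d| * excess ν |b - c|)) := by ring
  rw [h9, ← h8, Finset.mul_sum, Finset.mul_sum, Finset.mul_sum, Finset.mul_sum, Finset.mul_sum,
    ← Finset.sum_add_distrib]
  refine Finset.sum_congr rfl fun q _ => ?_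
  ring

lemma integral_centered_mul (h : IsMGInfinity P lam ν τ σ) (hlam : 0 ≤ lam)
    (hI : Integrable id ν) (a b : ℝ) :
    Integrable (fun ω => centered lam ν τ σ a ω * centered lam ν τ σ b ω) P ∧
    ∫ ω, centered lam ν τ σ a ω * centered lam ν τ σ b ω ∂P = lam * excess ν |a - b| := by
  have h1 : ∀ t, ∫ ω, centered lam ν τ σ t ω ^ 2 ∂P = lam * excess ν 0 ∧
      Integrable (fun ω => centered lam ν τ σ t ω ^ 2) P := fun t => by
    have := h.integral_sum_centered_sq hlam hI {()} (θ := fun _ => 1) (by simp) (fun _ => t)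
    have h' := h.integrable_sum_centered_pow hlam hI {()} (θ := fun _ => 1) (by simp) (fun _ => t) 2
    simp only [Finset.sum_singleton, one_mul, sub_self, abs_zero] at this h'
    exact ⟨this, h'⟩
  have h2 := h.integral_sum_centered_sq hlam hI Finset.univ (θ := fun _ : Fin 2 => 1) (by simp)
    ![a, b]
  have h3 := h.integrable_sum_centered_pow hlam hI Finset.univ (θ := fun _ : Fin 2 => 1) (by simp)
    ![a, b] 2
  simp only [Fin.sum_univ_two, one_mul, Matrix.cons_val, sub_self, abs_zero] at h2 h3
  have hY : ∀ ω, centered lam ν τ σ a ω * centered lam ν τ σ b ω = 2⁻¹ *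
      ((centered lam ν τ σ a ω + centered lam ν τ σ b ω) ^ 2 - centered lam ν τ σ a ω ^ 2
        - centered lam ν τ σ b ω ^ 2) := fun ω => by ring
  simp_rw [hY]
  refine ⟨((h3.sub (h1 a).2).sub (h1 b).2).const_mul _, ?_⟩
  have h4 := integral_sub (h3.sub (h1 a).2) (h1 b).2
  simp only [Pi.sub_apply] at h4
  rw [integral_const_mul, h4, integral_sub h3 (h1 a).2, h2,
    (h1 a).1, (h1 b).1, abs_sub_comm b a]
  ring

end IsMGInfinity

end MGInf

end

/-! ### The mean squared error of the empirical covariances -/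

noncomputable section

namespace MGInf

open scoped ENNReal

/-- The shift `c` drops out, so the observations may be centered. As the same ρ̂ is subtracted from
both factors, its square cancels against one cross term and exactly the product of the two means
remains. -/
lemma covHat_eq {n k : ℕ} (hk : k < n) (x y : ℕ → ℝ) (c : ℝ) (hxy : ∀ i, x i = y i + c) :
    covHat n x k = ∑ i ∈ Finset.Icc 1 (n - k), ((n - k : ℕ) : ℝ)⁻¹ * (y i * y (i + k))
      - (∑ i ∈ Finset.Icc 1 (n - k), ((n - k : ℕ) : ℝ)⁻¹ * y i)
        * ∑ i ∈ Finset.Icc 1 (n - k), ((n - k : ℕ) : ℝ)⁻¹ * y (i + k) := by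
  have hm : ((n - k : ℕ) : ℝ) ≠ 0 := by
    have : n - k ≠ 0 := by omega
    exact_mod_cast this
  have hr : rhoHat n x k = ((n - k : ℕ) : ℝ)⁻¹ * ∑ i ∈ Finset.Icc 1 (n - k), y i + c := by
    rw [rhoHat, ← Nat.cast_sub hk.le, Finset.sum_congr rfl fun i _ => hxy i,
      Finset.sum_add_distrib, Finset.sum_const, Nat.card_Icc, add_tsub_cancel_right, nsmul_eq_mul]
    field_simp
  rw [covHat, hr, ← Nat.cast_sub hk.le, ← Finset.mul_sum, ← Finset.mul_sum, ← Finset.mul_sum]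
  set m := n - k
  set a := ∑ i ∈ Finset.Icc 1 m, y i with ha
  set b := ∑ i ∈ Finset.Icc 1 m, y (i + k) with hb
  have : ∑ i ∈ Finset.Icc 1 m, (x i - ((m : ℝ)⁻¹ * a + c)) * (x (i + k) - ((m : ℝ)⁻¹ * a + c))
      = ∑ i ∈ Finset.Icc 1 m, (y i * y (i + k)) - (m : ℝ)⁻¹ * a * b := by
    have h1 : ∀ i, (x i - ((m : ℝ)⁻¹ * a + c)) * (x (i + k) - ((m : ℝ)⁻¹ * a + c))
        = y i * y (i + k) - (m : ℝ)⁻¹ * a * y (i + k) - (m : ℝ)⁻¹ * a * y i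
          + ((m : ℝ)⁻¹ * a) ^ 2 := fun i => by
      rw [hxy, hxy]
      ring
    rw [Finset.sum_congr rfl fun i _ => h1 i, Finset.sum_add_distrib, Finset.sum_sub_distrib,
      Finset.sum_sub_distrib, ← Finset.mul_sum, ← Finset.mul_sum, ← ha, ← hb, Finset.sum_const,
      Nat.card_Icc, add_tsub_cancel_right, nsmul_eq_mul]
    field_simp
    ring
  rw [this]
  ring

variable {Ω : Type*} [MeasurableSpace Ω] {P : Measure Ω} {lam : ℝ} {ν : Measure ℝ}
  {τ σ : ℤ → Ω → ℝ}

/-- The variance of the mean of `m` consecutive observations. -/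
def meanVar (lam : ℝ) (ν : Measure ℝ) (δ : ℝ) (m : ℕ) : ℝ :=
  lam * ∑ i ∈ Finset.Icc 1 m, ∑ j ∈ Finset.Icc 1 m,
    (m : ℝ)⁻¹ * (m : ℝ)⁻¹ * excess ν |(i : ℝ) * δ - j * δ|

lemma sum_inv_Icc {m : ℕ} (hm : m ≠ 0) : ∑ _i ∈ Finset.Icc 1 m, (m : ℝ)⁻¹ = 1 := by
  rw [Finset.sum_const, Nat.card_Icc, add_tsub_cancel_right, nsmul_eq_mul]
  exact mul_inv_cancel₀ (by exact_mod_cast hm)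

lemma meanVar_nonneg (hlam : 0 ≤ lam) (δ : ℝ) (m : ℕ) : 0 ≤ meanVar lam ν δ m :=
  mul_nonneg hlam (Finset.sum_nonneg fun _ _ => Finset.sum_nonneg fun _ _ =>
    mul_nonneg (by positivity) (excess_nonneg _))

lemma meanVar_le [IsFiniteMeasure ν] (hlam : 0 ≤ lam) (hI : Integrable id ν) (δ : ℝ) {m : ℕ}
    (hm : m ≠ 0) : meanVar lam ν δ m ≤ lam * excess ν 0 := by
  refine mul_le_mul_of_nonneg_left ?_ hlam
  calc ∑ i ∈ Finset.Icc 1 m, ∑ j ∈ Finset.Icc 1 m,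
        (m : ℝ)⁻¹ * (m : ℝ)⁻¹ * excess ν |(i : ℝ) * δ - j * δ|
      ≤ ∑ i ∈ Finset.Icc 1 m, ∑ j ∈ Finset.Icc 1 m, (m : ℝ)⁻¹ * (m : ℝ)⁻¹ * excess ν 0 :=
        Finset.sum_le_sum fun i _ => Finset.sum_le_sum fun j _ =>
          mul_le_mul_of_nonneg_left (excess_anti hI (abs_nonneg _)) (by positivity)
    _ = excess ν 0 := by
        have : ∑ j ∈ Finset.Icc 1 m, (m : ℝ)⁻¹ * (m : ℝ)⁻¹ * excess ν 0
            = (m : ℝ)⁻¹ * excess ν 0 := by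
          rw [← Finset.sum_mul, ← Finset.mul_sum, sum_inv_Icc hm, mul_one]
        rw [Finset.sum_congr rfl fun i _ => this, ← Finset.sum_mul, sum_inv_Icc hm, one_mul]

namespace IsMGInfinity

variable [IsProbabilityMeasure P] [IsProbabilityMeasure ν]

/-- The shift by `k` does not matter, because covariances depend on time differences only. With v =
`meanVar`, the fourth moment is at most 3v² + v, and v ≤ λH(0). -/
lemma integral_mean_centered (h : IsMGInfinity P lam ν τ σ) (hlam : 0 ≤ lam)
    (hI : Integrable id ν) (δ : ℝ) (k : ℕ) {m : ℕ} (hm : m ≠ 0) :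
    Integrable (fun ω => (∑ i ∈ Finset.Icc 1 m,
        (m : ℝ)⁻¹ * centered lam ν τ σ ((i + k : ℕ) * δ) ω) ^ 4) P ∧
    ∫ ω, (∑ i ∈ Finset.Icc 1 m, (m : ℝ)⁻¹ * centered lam ν τ σ ((i + k : ℕ) * δ) ω) ^ 4 ∂P
      ≤ (3 * (lam * excess ν 0) + 1) * meanVar lam ν δ m := by
  have hθ : ∀ i ∈ Finset.Icc 1 m, 0 ≤ (m : ℝ)⁻¹ := fun _ _ => by positivity
  refine ⟨h.integrable_sum_centered_pow hlam hI _ hθ (fun i : ℕ => ((i + k : ℕ) : ℝ) * δ) 4, ?_⟩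
  have h2 := h.integral_sum_centered_sq hlam hI _ hθ (fun i : ℕ => ((i + k : ℕ) : ℝ) * δ)
  have h4 := h.integral_sum_centered_pow_four_le hlam hI _ hθ (sum_inv_Icc hm).le
    (fun i : ℕ => ((i + k : ℕ) : ℝ) * δ)
  rw [h2] at h4
  have he : lam * ∑ i ∈ Finset.Icc 1 m, ∑ j ∈ Finset.Icc 1 m,
      (m : ℝ)⁻¹ * (m : ℝ)⁻¹ * excess ν |((i + k : ℕ) : ℝ) * δ - ((j + k : ℕ) : ℝ) * δ|
      = meanVar lam ν δ m := by
    rw [meanVar]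
    congr 1
    refine Finset.sum_congr rfl fun i _ => Finset.sum_congr rfl fun j _ => ?_
    congr 3
    push_cast
    ring
  rw [he] at h4
  have h5 := meanVar_le hlam hI δ hm
  have h6 := meanVar_nonneg (ν := ν) hlam δ m
  nlinarith

/-- The covariance of two products of pairs of queue lengths with the same lag. -/
lemma integral_mul_lag_sub (h : IsMGInfinity P lam ν τ σ) (hlam : 0 ≤ lam)
    (hI : Integrable id ν) (a b r : ℝ) (hr : 0 ≤ r) :
    Integrable (fun ω => (centered lam ν τ σ a ω * centered lam ν τ σ (a + r) ω
        - lam * excess ν r) * (centered lam ν τ σ b ω * centered lam ν τ σ (b + r) ω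
        - lam * excess ν r)) P ∧
    ∫ ω, (centered lam ν τ σ a ω * centered lam ν τ σ (a + r) ω
        - lam * excess ν r) * (centered lam ν τ σ b ω * centered lam ν τ σ (b + r) ω
        - lam * excess ν r) ∂P
      ≤ (2 * (lam * excess ν 0) + 1) * (lam * excess ν |a - b|) := by
  obtain ⟨i4, e4⟩ := h.integral_centered_mul_four hlam hI a (a + r) b (b + r)
  obtain ⟨ia, ea⟩ := h.integral_centered_mul hlam hI a (a + r)
  obtain ⟨ib, eb⟩ := h.integral_centered_mul hlam hI b (b + r)
  have hr1 : |a - (a + r)| = r := by rw [sub_add_cancel_left, abs_neg, abs_of_nonneg hr]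
  have hr2 : |b - (b + r)| = r := by rw [sub_add_cancel_left, abs_neg, abs_of_nonneg hr]
  have hr3 : |a + r - (b + r)| = |a - b| := by rw [add_sub_add_right_eq_sub]
  rw [hr1] at ea
  rw [hr2] at eb
  rw [hr1, hr2, hr3] at e4
  set R := lam * excess ν r with hR
  have hexp : ∀ ω, (centered lam ν τ σ a ω * centered lam ν τ σ (a + r) ω - R) *
      (centered lam ν τ σ b ω * centered lam ν τ σ (b + r) ω - R)
      = centered lam ν τ σ a ω * centered lam ν τ σ (a + r) ω * centered lam ν τ σ b ω
        * centered lam ν τ σ (b + r) ω + (R ^ 2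
        - R * (centered lam ν τ σ a ω * centered lam ν τ σ (a + r) ω)
        - R * (centered lam ν τ σ b ω * centered lam ν τ σ (b + r) ω)) := fun ω => by ring
  simp_rw [hexp]
  have i1 : Integrable (fun ω => R ^ 2
      - R * (centered lam ν τ σ a ω * centered lam ν τ σ (a + r) ω)) P :=
    (integrable_const _).sub (ia.const_mul R)
  have i2 : Integrable (fun ω => R ^ 2
      - R * (centered lam ν τ σ a ω * centered lam ν τ σ (a + r) ω)
      - R * (centered lam ν τ σ b ω * centered lam ν τ σ (b + r) ω)) P :=
    i1.sub (ib.const_mul R)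
  refine ⟨i4.add i2, ?_⟩
  rw [integral_add i4 i2, integral_sub i1 (ib.const_mul R),
    integral_sub (integrable_const _) (ia.const_mul R), integral_const_mul, integral_const_mul,
    ea, eb, e4, integral_const]
  -- The fourth cumulant: two of the four indicators are dropped.
  have hg : ∫ p, present a p * present (a + r) p * present b p * present (b + r) p
      ∂(volume.prod ν) ≤ excess ν |a - b| := by
    rw [← (integrable_present_mul hI a b).2]
    refine integral_mono_of_nonneg (Filter.Eventually.of_forall fun p => ?_)
      (integrable_present_mul hI a b).1 (Filter.Eventually.of_forall fun p => ?_)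
    · have := present_nonneg
      exact mul_nonneg (mul_nonneg (mul_nonneg (this _ _) (this _ _)) (this _ _)) (this _ _)
    · have h0 := mul_nonneg (present_nonneg a p) (present_nonneg b p)
      have h1 := mul_le_one₀ (present_le_one (a + r) p) (present_nonneg (b + r) p)
        (present_le_one (b + r) p)
      have := mul_le_mul_of_nonneg_left h1 h0
      simp only
      linarith
  -- One of the two crossed lags is at least |a - b|, depending on the order of a and b; the other
  -- factor is bounded by H(0).
  have hcross : excess ν |a - (b + r)| * excess ν |a + r - b| ≤ excess ν 0 * excess ν |a - b| := by
    rcases le_total a b with hab | hab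
    · have h1 : excess ν |a - (b + r)| ≤ excess ν |a - b| := by
        refine excess_anti hI ?_
        rw [abs_of_nonpos (by linarith), abs_of_nonpos (by linarith)]
        linarith
      have h2 : excess ν |a + r - b| ≤ excess ν 0 := excess_anti hI (abs_nonneg _)
      rw [mul_comm (excess ν 0)]
      exact mul_le_mul h1 h2 (excess_nonneg _) (excess_nonneg _)
    · have h1 : excess ν |a + r - b| ≤ excess ν |a - b| := by
        refine excess_anti hI ?_
        rw [abs_of_nonneg (by linarith), abs_of_nonneg (by linarith)]
        linarith
      have h2 : excess ν |a - (b + r)| ≤ excess ν 0 := excess_anti hI (abs_nonneg _)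
      exact mul_le_mul h2 h1 (excess_nonneg _) (excess_nonneg _)
  have hsq : excess ν |a - b| * excess ν |a - b| ≤ excess ν 0 * excess ν |a - b| :=
    mul_le_mul_of_nonneg_right (excess_anti hI (abs_nonneg _)) (excess_nonneg _)
  have hg' := mul_le_mul_of_nonneg_left hg hlam
  have hl2 : 0 ≤ lam ^ 2 := sq_nonneg _
  have h3 := mul_le_mul_of_nonneg_left (add_le_add hcross hsq) hl2
  simp only [probReal_univ, one_smul]
  rw [hR]
  nlinarith

/-- The mean squared error of the empirical covariances. -/
lemma integral_covHat_sub_sq_le (h : IsMGInfinity P lam ν τ σ) (hlam : 0 ≤ lam)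
    (hI : Integrable id ν) {δ : ℝ} (hδ : 0 ≤ δ) {n k : ℕ} (hk : k < n) :
    Measurable (fun ω => covHat n (fun i => queueLength τ σ (i * δ) ω) k
        - lam * excess ν (k * δ)) ∧
    Integrable (fun ω => (covHat n (fun i => queueLength τ σ (i * δ) ω) k
        - lam * excess ν (k * δ)) ^ 2) P ∧
    ∫ ω, (covHat n (fun i => queueLength τ σ (i * δ) ω) k - lam * excess ν (k * δ)) ^ 2 ∂P
      ≤ 10 * (lam * excess ν 0 + 1) * meanVar lam ν δ (n - k) := by
  set m := n - k with hmdef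
  have hm : m ≠ 0 := by omega
  set R := lam * excess ν (k * δ) with hR
  let Y : ℕ → Ω → ℝ := fun i ω => centered lam ν τ σ (i * δ) ω
  have hYm : ∀ i, Measurable (Y i) := fun i => h.measurable_centered _
  have hcov : ∀ ω, covHat n (fun i => queueLength τ σ (i * δ) ω) k
      = ∑ i ∈ Finset.Icc 1 m, (m : ℝ)⁻¹ * (Y i ω * Y (i + k) ω)
      - (∑ i ∈ Finset.Icc 1 m, (m : ℝ)⁻¹ * Y i ω)
        * ∑ i ∈ Finset.Icc 1 m, (m : ℝ)⁻¹ * Y (i + k) ω := fun ω =>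
    covHat_eq hk _ (fun i => Y i ω) (lam * excess ν 0) fun i => by simp [Y, centered]
  obtain ⟨j1, b1⟩ := h.integral_mean_centered hlam hI δ 0 hm
  obtain ⟨j2, b2⟩ := h.integral_mean_centered hlam hI δ k hm
  simp only [add_zero] at j1 b1
  change Integrable (fun ω => (∑ i ∈ Finset.Icc 1 m, (m : ℝ)⁻¹ * Y i ω) ^ 4) P at j1
  change Integrable (fun ω => (∑ i ∈ Finset.Icc 1 m, (m : ℝ)⁻¹ * Y (i + k) ω) ^ 4) P at j2
  change ∫ ω, (∑ i ∈ Finset.Icc 1 m, (m : ℝ)⁻¹ * Y i ω) ^ 4 ∂P ≤ _ at b1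
  change ∫ ω, (∑ i ∈ Finset.Icc 1 m, (m : ℝ)⁻¹ * Y (i + k) ω) ^ 4 ∂P ≤ _ at b2
  set D1 : Ω → ℝ := fun ω => ∑ i ∈ Finset.Icc 1 m, (m : ℝ)⁻¹ * Y i ω with hD1
  set D2 : Ω → ℝ := fun ω => ∑ i ∈ Finset.Icc 1 m, (m : ℝ)⁻¹ * Y (i + k) ω with hD2
  set A : Ω → ℝ := fun ω => ∑ i ∈ Finset.Icc 1 m, (m : ℝ)⁻¹ * (Y i ω * Y (i + k) ω) with hA
  have hAsq : ∀ ω, (A ω - R) ^ 2 = ∑ i ∈ Finset.Icc 1 m, ∑ j ∈ Finset.Icc 1 m,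
      (m : ℝ)⁻¹ * (m : ℝ)⁻¹ * ((Y i ω * Y (i + k) ω - R) * (Y j ω * Y (j + k) ω - R)) := by
    intro ω
    have : A ω - R = ∑ i ∈ Finset.Icc 1 m, (m : ℝ)⁻¹ * (Y i ω * Y (i + k) ω - R) := by
      simp_rw [mul_sub]
      rw [Finset.sum_sub_distrib, ← Finset.sum_mul, sum_inv_Icc hm, one_mul]
    rw [this, sq, Finset.sum_mul_sum]
    exact Finset.sum_congr rfl fun i _ => Finset.sum_congr rfl fun j _ => by ring
  have hlag : ∀ i j : ℕ, Integrable (fun ω => (Y i ω * Y (i + k) ω - R)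
        * (Y j ω * Y (j + k) ω - R)) P ∧
      ∫ ω, (Y i ω * Y (i + k) ω - R) * (Y j ω * Y (j + k) ω - R) ∂P
        ≤ (2 * (lam * excess ν 0) + 1) * (lam * excess ν |(i : ℝ) * δ - j * δ|) := by
    intro i j
    have hcast : ∀ i : ℕ, (i : ℝ) * δ + k * δ = ((i + k : ℕ) : ℝ) * δ := fun i => by
      push_cast
      ring
    have := h.integral_mul_lag_sub hlam hI (i * δ) (j * δ) (k * δ) (by positivity)
    rw [hcast, hcast] at this
    exact this
  have jA : Integrable (fun ω => (A ω - R) ^ 2) P := by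
    simp_rw [hAsq]
    exact integrable_finsetSum _ fun i _ => integrable_finsetSum _ fun j _ =>
      (hlag i j).1.const_mul _
  have bA : ∫ ω, (A ω - R) ^ 2 ∂P ≤ (2 * (lam * excess ν 0) + 1) * meanVar lam ν δ m := by
    simp_rw [hAsq]
    rw [integral_finsetSum _ fun i _ => integrable_finsetSum _ fun j _ =>
      (hlag i j).1.const_mul _, meanVar, Finset.mul_sum, Finset.mul_sum]
    refine Finset.sum_le_sum fun i _ => ?_
    rw [integral_finsetSum _ fun j _ => (hlag i j).1.const_mul _, Finset.mul_sum, Finset.mul_sum]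
    refine Finset.sum_le_sum fun j _ => ?_
    rw [integral_const_mul]
    have := mul_le_mul_of_nonneg_left (hlag i j).2 (by positivity : 0 ≤ (m : ℝ)⁻¹ * (m : ℝ)⁻¹)
    linarith
  have hmD1 : Measurable D1 := Finset.measurable_sum _ fun i _ => (hYm i).const_mul _
  have hmD2 : Measurable D2 := Finset.measurable_sum _ fun i _ => (hYm (i + k)).const_mul _
  have hmA : Measurable A :=
    Finset.measurable_sum _ fun i _ => ((hYm i).mul (hYm (i + k))).const_mul _
  have j12 : Integrable (fun ω => D1 ω ^ 4 + D2 ω ^ 4) P := j1.add j2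
  have e12 : ∫ ω, (D1 ω ^ 4 + D2 ω ^ 4) ∂P = ∫ ω, D1 ω ^ 4 ∂P + ∫ ω, D2 ω ^ 4 ∂P :=
    integral_add j1 j2
  -- From (x - y)² ≤ 2x² + 2y² and 2 D1² D2² ≤ D1⁴ + D2⁴.
  have hle : ∀ ω, (A ω - D1 ω * D2 ω - R) ^ 2
      ≤ 2 * (A ω - R) ^ 2 + (D1 ω ^ 4 + D2 ω ^ 4) := fun ω => by
    nlinarith [sq_nonneg (A ω - R + D1 ω * D2 ω), sq_nonneg (D1 ω ^ 2 - D2 ω ^ 2)]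
  have jB : Integrable (fun ω => 2 * (A ω - R) ^ 2 + (D1 ω ^ 4 + D2 ω ^ 4)) P :=
    (jA.const_mul 2).add j12
  simp_rw [hcov]
  refine ⟨(hmA.sub (hmD1.mul hmD2)).sub_const R, ?_, ?_⟩
  · refine jB.mono' (((hmA.sub (hmD1.mul hmD2)).sub_const R).pow_const 2).aestronglyMeasurable
      (Filter.Eventually.of_forall fun ω => ?_)
    rw [Real.norm_of_nonneg (sq_nonneg _)]
    exact hle ω
  · calc _ ≤ ∫ ω, (2 * (A ω - R) ^ 2 + (D1 ω ^ 4 + D2 ω ^ 4)) ∂P :=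
          integral_mono_of_nonneg (Filter.Eventually.of_forall fun ω => sq_nonneg _) jB
            (Filter.Eventually.of_forall hle)
      _ = 2 * ∫ ω, (A ω - R) ^ 2 ∂P + (∫ ω, D1 ω ^ 4 ∂P + ∫ ω, D2 ω ^ 4 ∂P) := by
          rw [integral_add (jA.const_mul 2) j12, integral_const_mul, e12]
      -- With x = λH(0) the factors add up to 2(2x + 1) + 2(3x + 1) = 10x + 4.
      _ ≤ _ := by linarith [meanVar_nonneg (ν := ν) hlam δ m]

end IsMGInfinity

end MGInf

end

/-! ### Existence and size of the optimal weights -/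

noncomputable section

namespace MGInf

/-- The feasible vectors form a closed convex set in a Euclidean space, and a nonempty one has a
point of least norm. Without existence the choice in `weights` would carry no information. -/
lemma exists_isOptimal {M : Finset ℕ} {δ : ℝ} {ℓ : ℕ} {x : ℝ} (hb : ∃ b, IsFeasible M δ ℓ x b) :
    ∃ a, IsOptimal M δ ℓ x a := by
  let K : Set (EuclideanSpace ℝ M) := {v | ∑ k : M, v k = 0 ∧
    ∀ j ∈ Finset.Icc 1 ℓ, ∑ k : M, v k * (((k : ℕ) : ℝ) * δ) ^ j = (j : ℝ) * x ^ (j - 1)}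
  have hmem : ∀ b : ℕ → ℝ, IsFeasible M δ ℓ x b ↔
      (WithLp.toLp 2 fun k : M => b k : EuclideanSpace ℝ M) ∈ K := by
    intro b
    refine and_congr (by rw [Finset.sum_coe_sort M b]) (forall₂_congr fun j _ => ?_)
    rw [Finset.sum_coe_sort M fun k => b k * ((k : ℝ) * δ) ^ j]
  have hclosed : IsClosed K := by
    have e : K = {v : EuclideanSpace ℝ M | ∑ k : M, v k = 0} ∩ ⋂ j ∈ Finset.Icc 1 ℓ,
        {v : EuclideanSpace ℝ M |
          ∑ k : M, v k * (((k : ℕ) : ℝ) * δ) ^ j = (j : ℝ) * x ^ (j - 1)} := by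
      ext v
      simp [K]
    rw [e]
    refine IsClosed.inter (isClosed_eq (by fun_prop) continuous_const) ?_
    exact isClosed_iInter fun j => isClosed_iInter fun _ =>
      isClosed_eq (by fun_prop) continuous_const
  have hconv : Convex ℝ K := by
    intro v hv w hw s t _ _ hst
    refine ⟨?_, fun j hj => ?_⟩
    · simp only [PiLp.add_apply, PiLp.smul_apply, smul_eq_mul, Finset.sum_add_distrib,
        ← Finset.mul_sum]
      rw [hv.1, hw.1]
      ring
    · have e : ∀ k : M, (s • v + t • w) k * (((k : ℕ) : ℝ) * δ) ^ j
          = s * (v k * (((k : ℕ) : ℝ) * δ) ^ j) + t * (w k * (((k : ℕ) : ℝ) * δ) ^ j) := fun k => by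
        simp only [PiLp.add_apply, PiLp.smul_apply, smul_eq_mul]
        ring
      rw [Finset.sum_congr rfl fun k _ => e k, Finset.sum_add_distrib, ← Finset.mul_sum,
        ← Finset.mul_sum, hv.2 j hj, hw.2 j hj, ← add_mul, hst, one_mul]
  obtain ⟨b, hb⟩ := hb
  obtain ⟨v, hvK, hv⟩ := exists_norm_eq_iInf_of_complete_convex ⟨_, (hmem b).1 hb⟩
    hclosed.isComplete hconv 0
  have hmin : ∀ w ∈ K, ‖v‖ ≤ ‖w‖ := by
    intro w hw
    have h1 : ⨅ w : K, ‖(0 : EuclideanSpace ℝ M) - w‖ ≤ ‖(0 : EuclideanSpace ℝ M) - w‖ :=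
      ciInf_le ⟨0, by rintro _ ⟨z, rfl⟩; exact norm_nonneg _⟩ (⟨w, hw⟩ : K)
    rw [← hv] at h1
    simpa using h1
  let a : ℕ → ℝ := fun k => if hk : k ∈ M then v ⟨k, hk⟩ else 0
  have hav : (WithLp.toLp 2 fun k : M => a k : EuclideanSpace ℝ M) = v := by
    ext k
    simp [a]
  refine ⟨a, (hmem a).2 (hav ▸ hvK), fun c hc => ?_⟩
  have h1 := hmin _ ((hmem c).1 hc)
  rw [← hav] at h1
  have h2 := pow_le_pow_left₀ (norm_nonneg _) h1 2
  rw [EuclideanSpace.norm_sq_eq, EuclideanSpace.norm_sq_eq] at h2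
  simp only [Real.norm_eq_abs, sq_abs] at h2
  rwa [Finset.sum_coe_sort M fun k => a k ^ 2, Finset.sum_coe_sort M fun k => c k ^ 2] at h2

open Polynomial in
/-- The derivative at `z` of the `r`-th Lagrange basis polynomial with nodes `0, …, ℓ`. -/
def lagrangeDeriv (ℓ r : ℕ) (z : ℝ) : ℝ :=
  (derivative (Lagrange.basis (Finset.range (ℓ + 1)) (fun i : ℕ => (i : ℝ)) r)).eval z

open Polynomial in
-- Lagrange interpolation reproduces ((X + y)c)^j; its derivative is evaluated at -y, where the base
-- vanishes. For j = 0 the factor j gives 0, and for j = 1 the convention 0⁰ = 1 gives c.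
lemma sum_pow_mul_lagrangeDeriv {ℓ j : ℕ} (hj : j ≤ ℓ) (c y : ℝ) :
    ∑ r ∈ Finset.range (ℓ + 1), ((r + y) * c) ^ j * lagrangeDeriv ℓ r (-y)
      = c * (j * 0 ^ (j - 1)) := by
  set p : ℝ[X] := ((X + C y) * C c) ^ j with hp
  have hdeg : p.degree < (Finset.range (ℓ + 1)).card := by
    rw [Finset.card_range]
    refine lt_of_le_of_lt degree_le_natDegree ?_
    have h1 : p.natDegree ≤ j * 1 := natDegree_pow_le_of_le j
      ((natDegree_mul_C_le _ _).trans (natDegree_X_add_C y).le)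
    exact_mod_cast (by omega : p.natDegree < ℓ + 1)
  have hinj : Set.InjOn (fun i : ℕ => (i : ℝ)) (Finset.range (ℓ + 1)) :=
    fun a _ b _ h => Nat.cast_injective h
  have h1 := Lagrange.eq_interpolate hinj hdeg
  have h2 := congrArg (fun q => (derivative q).eval (-y)) h1
  simp only [Lagrange.interpolate_apply, derivative_sum, derivative_mul, derivative_C, zero_mul,
    zero_add, eval_finsetSum, eval_mul, eval_C] at h2
  have h3 : ∀ r : ℕ, p.eval (r : ℝ) = ((r + y) * c) ^ j := fun r => by simp [hp]
  simp only [h3] at h2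
  unfold lagrangeDeriv
  rw [← h2, hp, derivative_pow]
  simp
  ring

lemma exists_lagrangeDeriv_le (ℓ : ℕ) : ∃ C : ℝ, 0 < C ∧ ∀ r ∈ Finset.range (ℓ + 1),
    ∀ y ∈ Set.Icc (0 : ℝ) 1, |lagrangeDeriv ℓ r (-y)| ≤ C := by
  have h : ∀ r : ℕ, ∃ C : ℝ, ∀ y ∈ Set.Icc (0 : ℝ) 1, |lagrangeDeriv ℓ r (-y)| ≤ C := by
    intro r
    refine isCompact_Icc.exists_bound_of_continuousOn (f := fun y => lagrangeDeriv ℓ r (-y)) ?_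
    unfold lagrangeDeriv
    fun_prop
  choose C hC using h
  refine ⟨1 + ∑ r ∈ Finset.range (ℓ + 1), |C r|, by positivity, fun r hr y hy => ?_⟩
  have h1 := Finset.single_le_sum (f := fun r => |C r|) (fun _ _ => abs_nonneg _) hr
  have h2 := (hC r y hy).trans (le_abs_self _)
  linarith

/-- Weights of the derivative at `0`, averaged over `m` shifted equispaced grids. -/
def gridWeights (m ℓ : ℕ) (δ : ℝ) (k : ℕ) : ℝ :=
  ∑ r ∈ Finset.range (ℓ + 1), ∑ i ∈ Finset.Icc 1 m, if k = i + r * m then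
    (m : ℝ)⁻¹ * (m * δ)⁻¹ * lagrangeDeriv ℓ r (-(i / m)) else 0

/-- The i-th grid has nodes (i + rm)δ = (r + i/m)·mδ, 0 ≤ r ≤ ℓ, and its Lagrange rule is exact up
to degree ℓ. Averaging over i keeps the exactness and spreads the weight over all m(ℓ + 1) points,
which lowers the ℓ² norm. -/
lemma sum_gridWeights {m ℓ N : ℕ} {δ : ℝ} (hδ : 0 < δ) (hm : 0 < m) (hN : m * (ℓ + 1) ≤ N) {j : ℕ}
    (hj : j ≤ ℓ) :
    ∑ k ∈ Finset.Icc 1 N, gridWeights m ℓ δ k * (k * δ) ^ j = j * 0 ^ (j - 1) := by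
  have hm' : (0 : ℝ) < m := by exact_mod_cast hm
  have h1 : ∀ r ∈ Finset.range (ℓ + 1), ∀ i ∈ Finset.Icc 1 m,
      ∑ k ∈ Finset.Icc 1 N, (if k = i + r * m then
        (m : ℝ)⁻¹ * (m * δ)⁻¹ * lagrangeDeriv ℓ r (-(i / m)) else 0) * (k * δ) ^ j
      = (m : ℝ)⁻¹ * (m * δ)⁻¹ * (((r + i / m) * (m * δ)) ^ j * lagrangeDeriv ℓ r (-(i / m))) := by
    intro r hr i hi
    rw [Finset.mem_range] at hr
    rw [Finset.mem_Icc] at hi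
    have hmem : i + r * m ∈ Finset.Icc 1 N := by
      rw [Finset.mem_Icc]
      have : r * m ≤ ℓ * m := Nat.mul_le_mul_right m (by omega)
      constructor
      · omega
      · nlinarith
    simp only [ite_mul, zero_mul]
    rw [Finset.sum_ite_eq' _ _ (fun k : ℕ => (m : ℝ)⁻¹ * (m * δ)⁻¹ * lagrangeDeriv ℓ r (-(i / m))
      * (k * δ) ^ j), if_pos hmem]
    have : ((i + r * m : ℕ) : ℝ) * δ = (r + i / m) * (m * δ) := by
      push_cast
      field_simp
      ring
    rw [this]
    ring
  have h2 : ∑ k ∈ Finset.Icc 1 N, gridWeights m ℓ δ k * (k * δ) ^ j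
      = ∑ r ∈ Finset.range (ℓ + 1), ∑ i ∈ Finset.Icc 1 m, (m : ℝ)⁻¹ * (m * δ)⁻¹ *
        (((r + i / m) * (m * δ)) ^ j * lagrangeDeriv ℓ r (-(i / m))) := by
    unfold gridWeights
    simp_rw [Finset.sum_mul]
    rw [Finset.sum_comm]
    refine Finset.sum_congr rfl fun r hr => ?_
    rw [Finset.sum_comm]
    exact Finset.sum_congr rfl fun i hi => h1 r hr i hi
  rw [h2, Finset.sum_comm]
  simp_rw [← Finset.mul_sum, sum_pow_mul_lagrangeDeriv hj]
  rw [Finset.sum_const, Nat.card_Icc, add_tsub_cancel_right, nsmul_eq_mul]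
  field_simp

lemma abs_gridWeights_le {m ℓ : ℕ} {δ C : ℝ} (hδ : 0 < δ) (hm : 0 < m) (hC : 0 ≤ C)
    (h : ∀ r ∈ Finset.range (ℓ + 1), ∀ y ∈ Set.Icc (0 : ℝ) 1, |lagrangeDeriv ℓ r (-y)| ≤ C)
    (k : ℕ) : |gridWeights m ℓ δ k| ≤ (ℓ + 1) * ((m : ℝ)⁻¹ * (m * δ)⁻¹ * C) := by
  have hm' : (0 : ℝ) < m := by exact_mod_cast hm
  have h1 : ∀ r ∈ Finset.range (ℓ + 1), |∑ i ∈ Finset.Icc 1 m, if k = i + r * m then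
      (m : ℝ)⁻¹ * (m * δ)⁻¹ * lagrangeDeriv ℓ r (-(i / m)) else 0|
      ≤ (m : ℝ)⁻¹ * (m * δ)⁻¹ * C := by
    intro r hr
    rw [← Finset.sum_filter]
    have hcard : ((Finset.Icc 1 m).filter fun i => k = i + r * m).card ≤ 1 := by
      refine Finset.card_le_one.2 fun a ha b hb => ?_
      have := (Finset.mem_filter.1 ha).2
      have := (Finset.mem_filter.1 hb).2
      omega
    refine (Finset.abs_sum_le_sum_abs _ _).trans ((Finset.sum_le_card_nsmul _ _
      ((m : ℝ)⁻¹ * (m * δ)⁻¹ * C) fun i hi => ?_).trans ?_)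
    · rw [abs_mul, abs_of_nonneg (by positivity : 0 ≤ (m : ℝ)⁻¹ * (m * δ)⁻¹)]
      refine mul_le_mul_of_nonneg_left (h r hr _ ⟨by positivity, ?_⟩) (by positivity)
      have := (Finset.mem_Icc.1 (Finset.mem_filter.1 hi).1).2
      rw [div_le_one hm']
      exact_mod_cast this
    · rw [nsmul_eq_mul]
      exact mul_le_of_le_one_left (by positivity) (by exact_mod_cast hcard)
  refine (Finset.abs_sum_le_sum_abs _ _).trans ((Finset.sum_le_sum h1).trans ?_)
  rw [Finset.sum_const, Finset.card_range, nsmul_eq_mul]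
  push_cast
  rfl

lemma gridIndices_eq {n : ℕ} {δ h : ℝ} (hδ : 0 < δ) (hh : 0 ≤ h) (hn : 2 * h < n * δ) :
    gridIndices n δ (Set.Icc 0 (2 * h)) = Finset.Icc 1 ⌊2 * h / δ⌋₊ := by
  ext k
  simp only [gridIndices, Finset.mem_filter, Finset.mem_Icc, Set.mem_Icc]
  rw [Nat.le_floor_iff (by positivity), le_div_iff₀ hδ]
  constructor
  · exact fun h => ⟨h.1.1, h.2.2⟩
  · rintro ⟨h1, h2⟩
    refine ⟨⟨h1, ?_⟩, by positivity, h2⟩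
    have : (k : ℝ) * δ < n * δ := by linarith
    exact_mod_cast (lt_of_mul_lt_mul_right this hδ.le).le

/-- The optimal weights are feasible, and their `ℓ¹` norm is of the order `1 / h`. -/
lemma exists_sum_abs_weights_le (ℓ : ℕ) : ∃ C : ℝ, 0 < C ∧ ∀ (n : ℕ) (δ h : ℝ), 0 < δ →
    (ℓ + 2) * δ ≤ 2 * h → 2 * h < n * δ →
    IsFeasible (gridIndices n δ (Set.Icc 0 (2 * h))) δ ℓ 0
      (weights (gridIndices n δ (Set.Icc 0 (2 * h))) δ ℓ 0) ∧
    ∑ k ∈ gridIndices n δ (Set.Icc 0 (2 * h)),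
      |weights (gridIndices n δ (Set.Icc 0 (2 * h))) δ ℓ 0 k| ≤ C / h := by
  obtain ⟨C, hC, hCb⟩ := exists_lagrangeDeriv_le ℓ
  refine ⟨4 * (ℓ + 1) ^ 3 * C, by positivity, fun n δ h hδ hℓ hn => ?_⟩
  have hh : δ ≤ h := by nlinarith [(Nat.cast_nonneg ℓ : (0 : ℝ) ≤ ℓ)]
  have hh0 : 0 < h := hδ.trans_le hh
  rw [gridIndices_eq hδ hh0.le hn]
  set N := ⌊2 * h / δ⌋₊ with hN
  have hNℓ : ℓ + 2 ≤ N := by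
    rw [hN, Nat.le_floor_iff (by positivity), le_div_iff₀ hδ]
    push_cast
    exact hℓ
  -- From 2h < (N + 1)δ and δ ≤ h.
  have hNh : h ≤ N * δ := by
    have := Nat.lt_floor_add_one (2 * h / δ)
    rw [← hN, div_lt_iff₀ hδ] at this
    linarith
  set m := N / (ℓ + 1) with hm
  have hm0 : 0 < m := Nat.div_pos (by omega) (by omega)
  have hmN : m * (ℓ + 1) ≤ N := Nat.div_mul_le_self _ _
  have hNm : (N : ℝ) ≤ 2 * (m * (ℓ + 1)) := by
    have h1 : N < m * (ℓ + 1) + (ℓ + 1) := by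
      have := Nat.lt_div_mul_add (a := N) (b := ℓ + 1) (by omega)
      exact this
    have h2 : ℓ + 1 ≤ m * (ℓ + 1) := Nat.le_mul_of_pos_left _ hm0
    have h3 : N ≤ 2 * (m * (ℓ + 1)) := by omega
    exact_mod_cast h3
  have hfeas : IsFeasible (Finset.Icc 1 N) δ ℓ 0 (gridWeights m ℓ δ) := by
    refine ⟨?_, fun j hj => sum_gridWeights hδ hm0 hmN (Finset.mem_Icc.1 hj).2⟩
    have := sum_gridWeights hδ hm0 hmN (Nat.zero_le ℓ)
    simpa using this
  have hopt : IsOptimal (Finset.Icc 1 N) δ ℓ 0 (weights (Finset.Icc 1 N) δ ℓ 0) :=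
    Classical.epsilon_spec (exists_isOptimal ⟨_, hfeas⟩)
  refine ⟨hopt.1, ?_⟩
  set a := weights (Finset.Icc 1 N) δ ℓ 0
  set W : ℝ := (ℓ + 1) * ((m : ℝ)⁻¹ * (m * δ)⁻¹ * C) with hW
  have hm' : (0 : ℝ) < m := by exact_mod_cast hm0
  have hN' : (0 : ℝ) < N := by
    have : 0 < N := by omega
    exact_mod_cast this
  have hW0 : 0 ≤ W := by positivity
  -- Cauchy–Schwarz passes from ℓ¹ to ℓ², where optimality applies. Nothing is lost in order, since
  -- the comparison weights are uniformly of size at most W.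
  have h1 : (∑ k ∈ Finset.Icc 1 N, |a k|) ^ 2 ≤ (N * W) ^ 2 := by
    calc (∑ k ∈ Finset.Icc 1 N, |a k|) ^ 2
        ≤ (Finset.Icc 1 N).card * ∑ k ∈ Finset.Icc 1 N, |a k| ^ 2 := sq_sum_le_card_mul_sum_sq
      _ = N * ∑ k ∈ Finset.Icc 1 N, a k ^ 2 := by simp
      _ ≤ N * ∑ k ∈ Finset.Icc 1 N, gridWeights m ℓ δ k ^ 2 := by
          exact mul_le_mul_of_nonneg_left (hopt.2 _ hfeas) hN'.le
      _ ≤ N * ∑ k ∈ Finset.Icc 1 N, W ^ 2 := by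
          refine mul_le_mul_of_nonneg_left (Finset.sum_le_sum fun k _ => ?_) hN'.le
          rw [← sq_abs]
          exact pow_le_pow_left₀ (abs_nonneg _) (abs_gridWeights_le hδ hm0 hC.le hCb k) 2
      _ = (N * W) ^ 2 := by
          rw [Finset.sum_const, Nat.card_Icc, add_tsub_cancel_right, nsmul_eq_mul]
          ring
  have h2 := abs_le_of_sq_le_sq h1 (by positivity)
  refine (le_abs_self _).trans (h2.trans ?_)
  rw [le_div_iff₀ hh0]
  calc N * W * h ≤ N * W * (N * δ) := by gcongr
    _ = N ^ 2 * ((ℓ + 1) * C) / m ^ 2 := by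
        rw [hW]
        field_simp
    _ ≤ (2 * (m * (ℓ + 1))) ^ 2 * ((ℓ + 1) * C) / m ^ 2 := by gcongr
    _ = 4 * (ℓ + 1) ^ 3 * C := by
        field_simp
        ring

end MGInf

end

/-! ### The integrated tail: summability, Taylor approximation and bias -/

noncomputable section

namespace MGInf

open scoped ENNReal

section Law

variable {ν : Measure ℝ} {K : ℝ}

lemma IsServiceLaw.ae_pos (hν : IsServiceLaw ν) : ∀ᵐ s ∂ν, 0 < s := by
  rw [ae_iff]
  simp only [not_lt]
  exact hν.pos

lemma integral_sq_le (hν : ν ∈ momentClass 2 K) (hK : 0 ≤ K) :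
    Integrable (fun s => s ^ 2) ν ∧ ∫ s, s ^ 2 ∂ν ≤ K := by
  have h2 := hν.2
  simp only [Real.rpow_two] at h2
  have hi : Integrable (fun s : ℝ => s ^ 2) ν := by
    refine ⟨by fun_prop, ?_⟩
    rw [hasFiniteIntegral_iff_ofReal (Filter.Eventually.of_forall fun s => sq_nonneg s)]
    exact h2.trans_lt ENNReal.ofReal_lt_top
  refine ⟨hi, ?_⟩
  rw [← ofReal_integral_eq_lintegral_ofReal hi
    (Filter.Eventually.of_forall fun s => sq_nonneg s)] at h2
  exact (ENNReal.ofReal_le_ofReal_iff hK).1 h2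

lemma integrable_id_of_momentClass (hν : ν ∈ momentClass 2 K) (hK : 0 ≤ K) :
    Integrable id ν := by
  have := hν.1.prob
  refine ((integrable_const (1 : ℝ)).add (integral_sq_le hν hK).1).mono' (by fun_prop)
    (Filter.Eventually.of_forall fun s => ?_)
  simp only [id, Real.norm_eq_abs, Pi.add_apply]
  rw [← sq_abs]
  nlinarith [sq_nonneg (|s| - 1), abs_nonneg s]

lemma excess_zero (hν : IsServiceLaw ν) : excess ν 0 = ∫ s, s ∂ν := by
  refine integral_congr_ae (hν.ae_pos.mono fun s hs => ?_)
  simp [hs.le]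

/-- Jensen's inequality, in the form of a nonnegative variance. -/
lemma excess_zero_le_sqrt (hν : ν ∈ momentClass 2 K) (hK : 0 ≤ K) :
    excess ν 0 ≤ Real.sqrt K := by
  have := hν.1.prob
  obtain ⟨hi, hle⟩ := integral_sq_le hν hK
  have h1 := integrable_id_of_momentClass hν hK
  rw [excess_zero hν.1]
  refine Real.le_sqrt_of_sq_le (le_trans ?_ hle)
  set e := ∫ s, s ∂ν
  have h2 : 0 ≤ ∫ s, (s ^ 2 - 2 * e * s + e ^ 2) ∂ν :=
    integral_nonneg fun s => by
      have : s ^ 2 - 2 * e * s + e ^ 2 = (s - e) ^ 2 := by ring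
      rw [this]
      exact sq_nonneg _
  have h3 : Integrable (fun s : ℝ => 2 * e * s) ν := h1.const_mul _
  have h4 : Integrable (fun s : ℝ => s ^ 2 - 2 * e * s) ν := hi.sub h3
  rw [integral_add h4 (integrable_const _), integral_sub hi h3, integral_const_mul,
    integral_const] at h2
  simp only [probReal_univ, one_smul] at h2
  nlinarith

/-- The integrated tail as an integral of the distribution function. -/
lemma excess_eq (hν : IsServiceLaw ν) (hI : Integrable id ν) {t : ℝ} (ht : 0 ≤ t) :
    excess ν t = excess ν 0 - t + ∫ y in (0 : ℝ)..t, cdf ν y := by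
  have := hν.prob
  -- The remaining term E(t - σ)⁺ equals ∫₀ᵗ G by Fubini, because σ > 0 almost surely.
  have h1 : ∀ᵐ s ∂ν, max (s - t) 0 = s - t + max (t - s) 0 := by
    refine Filter.Eventually.of_forall fun s => ?_
    rcases le_total s t with h | h
    · rw [max_eq_right (by linarith), max_eq_left (by linarith)]
      ring
    · rw [max_eq_left (by linarith), max_eq_right (by linarith)]
      ring
  have hi : Integrable (fun s => max (t - s) 0) ν := ((integrable_const t).sub hI).pos_part
  have hi2 : Integrable (fun s : ℝ => s - t) ν := hI.sub (integrable_const t)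
  have hi3 : Integrable (fun s : ℝ => s) ν := hI
  rw [excess, integral_congr_ae h1, integral_add hi2 hi, integral_sub hi3 (integrable_const t),
    excess_zero hν, integral_const]
  simp only [probReal_univ, one_smul]
  congr 1
  rw [intervalIntegral.integral_of_le ht]
  have hc : ∀ y, cdf ν y = ∫ s, (Set.Iic y).indicator (fun _ => (1 : ℝ)) s ∂ν := fun y => by
    rw [cdf_eq_real, integral_indicator_const _ measurableSet_Iic]
    simp
  simp_rw [hc]
  have hms : MeasurableSet {p : ℝ × ℝ | p.2 ≤ p.1} := measurableSet_le measurable_snd measurable_fst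
  rw [integral_integral_swap]
  · refine integral_congr_ae (hν.ae_pos.mono fun s hs => ?_)
    have : (fun y => (Set.Iic y).indicator (fun _ => (1 : ℝ)) s)
        = (Set.Ici s).indicator fun _ => (1 : ℝ) := by
      ext y
      simp [Set.indicator_apply]
    simp only [this]
    rw [integral_indicator_const _ measurableSet_Ici, Measure.real,
      Measure.restrict_apply measurableSet_Ici]
    have h3 : Set.Ici s ∩ Set.Ioc 0 t = Set.Icc s t := by
      ext y
      simp only [Set.mem_inter_iff, Set.mem_Ici, Set.mem_Ioc, Set.mem_Icc]
      constructor
      · exact fun h => ⟨h.1, h.2.2⟩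
      · exact fun h => ⟨h.1, hs.trans_le h.1, h.2⟩
    rw [h3, Real.volume_Icc]
    rcases le_total s t with h | h
    · rw [ENNReal.toReal_ofReal (by linarith), max_eq_left (by linarith)]
      simp
    · rw [ENNReal.ofReal_of_nonpos (by linarith), max_eq_right (by linarith)]
      simp
  · have : (Function.uncurry fun y s => (Set.Iic y).indicator (fun _ => (1 : ℝ)) s)
        = {p : ℝ × ℝ | p.2 ≤ p.1}.indicator fun _ => 1 := by
      ext p
      simp [Set.indicator_apply, Function.uncurry]
    rw [this]
    exact (integrable_const _).indicator hms

/-- At most s/δ terms are nonzero, each at most s. After integration this is how the second moment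
controls the sum of the covariances. -/
lemma sum_pos_part_le {s δ : ℝ} (hs : 0 ≤ s) (hδ : 0 < δ) (m : ℕ) :
    ∑ q ∈ Finset.Icc 1 m, max (s - q * δ) 0 ≤ s ^ 2 / δ := by
  calc ∑ q ∈ Finset.Icc 1 m, max (s - q * δ) 0
      ≤ ∑ q ∈ Finset.Icc 1 m, if q ∈ Finset.Icc 1 ⌊s / δ⌋₊ then s else 0 := by
        refine Finset.sum_le_sum fun q hq => ?_
        split_ifs with h
        · exact max_le (by nlinarith [(Nat.cast_nonneg q : (0 : ℝ) ≤ q)]) hs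
        · rw [Finset.mem_Icc, not_and, Nat.le_floor_iff (by positivity), le_div_iff₀ hδ] at h
          have := h (Finset.mem_Icc.1 hq).1
          exact max_le (by linarith) le_rfl
    _ = ∑ q ∈ Finset.Icc 1 m ∩ Finset.Icc 1 ⌊s / δ⌋₊, s := by
        rw [Finset.sum_ite_mem]
    _ ≤ ∑ q ∈ Finset.Icc 1 ⌊s / δ⌋₊, s :=
        Finset.sum_le_sum_of_subset_of_nonneg Finset.inter_subset_right fun _ _ _ => hs
    _ = ⌊s / δ⌋₊ * s := by simp
    _ ≤ s / δ * s := mul_le_mul_of_nonneg_right (Nat.floor_le (by positivity)) hs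
    _ = s ^ 2 / δ := by ring

lemma sum_excess_le (hν : ν ∈ momentClass 2 K) (hK : 0 ≤ K) {δ : ℝ} (hδ : 0 < δ) (m : ℕ) :
    ∑ q ∈ Finset.Icc 1 m, excess ν (q * δ) ≤ K / δ := by
  have := hν.1.prob
  have hI := integrable_id_of_momentClass hν hK
  unfold excess
  rw [← integral_finsetSum _ fun q _ => integrable_excess hI _]
  calc ∫ s, ∑ q ∈ Finset.Icc 1 m, max (s - q * δ) 0 ∂ν ≤ ∫ s, s ^ 2 / δ ∂ν :=
        integral_mono_ae (integrable_finsetSum _ fun q _ => integrable_excess hI _)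
          ((integral_sq_le hν hK).1.div_const δ)
          (hν.1.ae_pos.mono fun s hs => sum_pos_part_le hs.le hδ m)
    _ = (∫ s, s ^ 2 ∂ν) / δ := integral_div _ _
    _ ≤ K / δ := by
        gcongr
        exact (integral_sq_le hν hK).2

lemma sum_ite_le {S : Finset ℕ} {p : ℕ → Prop} [DecidablePred p] {c : ℝ} (hc : 0 ≤ c)
    (hp : ∀ a b, p a → p b → a = b) : ∑ j ∈ S, (if p j then c else 0) ≤ c := by
  rw [← Finset.sum_filter, Finset.sum_const, nsmul_eq_mul]
  refine mul_le_of_le_one_left hc ?_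
  exact_mod_cast Finset.card_le_one.2 fun a ha b hb =>
    hp a b (Finset.mem_filter.1 ha).2 (Finset.mem_filter.1 hb).2

/-- Each row of the covariance matrix sums to at most H(0) plus twice the sum over positive lags. -/
lemma meanVar_le_div (hν : ν ∈ momentClass 2 K) (hK : 0 ≤ K) {lam δ : ℝ} (hlam : 0 ≤ lam)
    (hδ : 0 < δ) {m : ℕ} (hm : m ≠ 0) :
    meanVar lam ν δ m ≤ lam * ((m : ℝ)⁻¹ * (excess ν 0 + 2 * (K / δ))) := by
  refine mul_le_mul_of_nonneg_left ?_ hlam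
  have hrow : ∀ i ∈ Finset.Icc 1 m, ∑ j ∈ Finset.Icc 1 m, excess ν |(i : ℝ) * δ - j * δ|
      ≤ excess ν 0 + 2 * (K / δ) := by
    intro i hi
    -- A row is rewritten as a sum over lags q by indicators of j = i ± q, so that after exchanging
    -- sums each lag is counted at most twice.
    have hterm : ∀ j ∈ Finset.Icc 1 m, excess ν |(i : ℝ) * δ - j * δ|
        ≤ (if j = i then excess ν 0 else 0) + ∑ q ∈ Finset.Icc 1 m,
          ((if j = i + q then excess ν (q * δ) else 0)
            + if i = j + q then excess ν (q * δ) else 0) := by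
      intro j hj
      rw [Finset.mem_Icc] at hi hj
      have hnn : ∀ q ∈ Finset.Icc 1 m, 0 ≤ (if j = i + q then excess ν (q * δ) else 0)
            + if i = j + q then excess ν (q * δ) else 0 := fun q _ =>
        add_nonneg (by split_ifs <;> simp [excess_nonneg]) (by split_ifs <;> simp [excess_nonneg])
      rcases lt_trichotomy i j with hij | hij | hij
      · have hq : j - i ∈ Finset.Icc 1 m := Finset.mem_Icc.2 ⟨by omega, by omega⟩
        have h1 := Finset.single_le_sum hnn hq
        rw [if_pos (by omega), if_neg (by omega), add_zero] at h1
        rw [if_neg hij.ne', zero_add]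
        refine le_trans (le_of_eq ?_) h1
        congr 1
        rw [Nat.cast_sub hij.le, abs_sub_comm, ← sub_mul, abs_of_nonneg]
        have : (i : ℝ) ≤ j := by exact_mod_cast hij.le
        exact mul_nonneg (by linarith) hδ.le
      · rw [if_pos hij.symm, hij, sub_self, abs_zero]
        have := Finset.sum_nonneg hnn
        rw [hij] at this
        linarith
      · have hq : i - j ∈ Finset.Icc 1 m := Finset.mem_Icc.2 ⟨by omega, by omega⟩
        have h1 := Finset.single_le_sum hnn hq
        rw [if_neg (by omega), if_pos (by omega), zero_add] at h1
        rw [if_neg hij.ne, zero_add]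
        refine le_trans (le_of_eq ?_) h1
        congr 1
        rw [Nat.cast_sub hij.le, ← sub_mul, abs_of_nonneg]
        have : (j : ℝ) ≤ i := by exact_mod_cast hij.le
        exact mul_nonneg (by linarith) hδ.le
    refine (Finset.sum_le_sum hterm).trans ?_
    rw [Finset.sum_add_distrib, Finset.sum_comm]
    have h1 : ∑ j ∈ Finset.Icc 1 m, (if j = i then excess ν 0 else 0) ≤ excess ν 0 :=
      sum_ite_le (excess_nonneg _) fun a b ha hb => ha.trans hb.symm
    have h2 : ∀ q ∈ Finset.Icc 1 m, ∑ j ∈ Finset.Icc 1 m,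
        ((if j = i + q then excess ν (q * δ) else 0) + if i = j + q then excess ν (q * δ) else 0)
        ≤ 2 * excess ν (q * δ) := by
      intro q _
      rw [Finset.sum_add_distrib, two_mul]
      refine add_le_add (sum_ite_le (excess_nonneg _) ?_) (sum_ite_le (excess_nonneg _) ?_)
      · exact fun a b ha hb => ha.trans hb.symm
      · exact fun a b ha hb => by omega
    have h3 := Finset.sum_le_sum h2
    rw [← Finset.mul_sum] at h3
    linarith [sum_excess_le hν hK hδ m]
  calc ∑ i ∈ Finset.Icc 1 m, ∑ j ∈ Finset.Icc 1 m,
        (m : ℝ)⁻¹ * (m : ℝ)⁻¹ * excess ν |(i : ℝ) * δ - j * δ|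
      ≤ ∑ i ∈ Finset.Icc 1 m, (m : ℝ)⁻¹ * ((m : ℝ)⁻¹ * (excess ν 0 + 2 * (K / δ))) := by
        refine Finset.sum_le_sum fun i hi => ?_
        rw [← Finset.mul_sum, mul_assoc]
        gcongr
        exact hrow i hi
    _ = _ := by rw [← Finset.sum_mul, sum_inv_Icc hm, one_mul]

end Law

lemma strictFloor_lt {β : ℝ} (hβ : 0 < β) : (strictFloor β : ℝ) < β ∧ β ≤ strictFloor β + 1 := by
  have h1 : 0 < ⌈β⌉₊ := Nat.ceil_pos.2 hβ
  have h2 : strictFloor β + 1 = ⌈β⌉₊ := by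
    unfold strictFloor
    omega
  constructor
  · exact Nat.lt_ceil.1 (by omega)
  · have := Nat.le_ceil β
    rw [← h2] at this
    exact_mod_cast this

/-- Taylor approximation of a function with a Hölder continuous derivative of order `s`. -/
lemma exists_taylor_approx {f : ℝ → ℝ} {b L β : ℝ} {s : ℕ} (hb : 0 < b) (hL : 0 ≤ L)
    (hβ : (s : ℝ) < β) (hf : ContDiffOn ℝ s f (Set.Icc 0 b))
    (hH : ∀ x ∈ Set.Icc 0 b, ∀ y ∈ Set.Icc 0 b,
      |iteratedDerivWithin s f (Set.Icc 0 b) x - iteratedDerivWithin s f (Set.Icc 0 b) y|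
        ≤ L * |x - y| ^ (β - s)) :
    ∃ c : ℕ → ℝ, c 0 = f 0 ∧ ∀ x ∈ Set.Icc 0 b,
      |f x - ∑ i ∈ Finset.range (s + 1), c i * x ^ i| ≤ L * x ^ β := by
  have h0 : (0 : ℝ) ∈ Set.Icc 0 b := ⟨le_rfl, hb.le⟩
  refine ⟨fun i => (i.factorial : ℝ)⁻¹ * iteratedDerivWithin i f (Set.Icc 0 b) 0, by simp,
    fun x hx => ?_⟩
  rcases hx.1.eq_or_lt with rfl | hx0
  · rw [Finset.sum_range_succ']
    simp only [ne_eq, Nat.add_eq_zero_iff, one_ne_zero, and_false, not_false_eq_true, zero_pow,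
      mul_zero, Finset.sum_const_zero]
    simp
    positivity
  -- The Lagrange remainder uses one derivative beyond the polynomial part, so it needs s = r + 1.
  -- For s = 0 the claim is the Hölder condition itself.
  rcases s with _ | r
  · have := hH x hx 0 h0
    simpa [abs_of_pos hx0] using this
  · have hIcc : Set.uIcc 0 x = Set.Icc 0 x := Set.uIcc_of_le hx0.le
    obtain ⟨ξ, hξ, hξe⟩ := taylor_mean_remainder_lagrange_iteratedDeriv (f := f) (n := r) hx0.ne
      (by
        rw [hIcc]
        exact_mod_cast hf.mono (Set.Icc_subset_Icc_right hx.2))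
    rw [Set.uIoo_of_le hx0.le] at hξ
    have hξb : ξ ∈ Set.Ioo 0 b := ⟨hξ.1, hξ.2.trans_le hx.2⟩
    have e1 : iteratedDeriv (r + 1) f ξ = iteratedDerivWithin (r + 1) f (Set.Icc 0 b) ξ :=
      (iteratedDerivWithin_eq_iteratedDeriv (uniqueDiffOn_Icc hb)
        (hf.contDiffAt (Icc_mem_nhds hξb.1 hξb.2)) (Set.Ioo_subset_Icc_self hξb)).symm
    -- The intervals [0, x] and [0, b] coincide near 0, hence have the same one-sided derivatives
    -- there.
    have e2 : ∀ i, iteratedDerivWithin i f (Set.uIcc 0 x) 0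
        = iteratedDerivWithin i f (Set.Icc 0 b) 0 := by
      intro i
      rw [iteratedDerivWithin, iteratedDerivWithin, hIcc, iteratedFDerivWithin_congr_set]
      filter_upwards [Iio_mem_nhds hx0] with y (hy : y < x)
      refine propext ⟨fun h => ⟨h.1, hy.le.trans hx.2⟩, fun h => ⟨h.1, hy.le⟩⟩
    rw [taylor_within_apply, e1] at hξe
    simp only [e2, sub_zero, smul_eq_mul] at hξe
    rw [Finset.sum_range_succ]
    have h1 := hH ξ (Set.Ioo_subset_Icc_self hξb) 0 h0
    rw [sub_zero, abs_of_pos hξ.1] at h1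
    set D := iteratedDerivWithin (r + 1) f (Set.Icc 0 b) with hD
    -- The remainder has the top derivative at ξ, the polynomial has it at 0; the Hölder condition
    -- bounds the difference.
    have h2 : f x - (∑ i ∈ Finset.range (r + 1),
        (i.factorial : ℝ)⁻¹ * iteratedDerivWithin i f (Set.Icc 0 b) 0 * x ^ i
        + ((r + 1).factorial : ℝ)⁻¹ * D 0 * x ^ (r + 1))
        = (D ξ - D 0) * (x ^ (r + 1) / (r + 1).factorial) := by
      rw [← sub_sub, Finset.sum_congr rfl fun i _ => (by ring :
        (i.factorial : ℝ)⁻¹ * iteratedDerivWithin i f (Set.Icc 0 b) 0 * x ^ i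
        = (i.factorial : ℝ)⁻¹ * x ^ i * iteratedDerivWithin i f (Set.Icc 0 b) 0), hξe]
      ring
    rw [h2, abs_mul, abs_of_nonneg (by positivity : 0 ≤ x ^ (r + 1) / ((r + 1).factorial : ℝ))]
    have h3 : x ^ (r + 1) / ((r + 1).factorial : ℝ) ≤ x ^ (r + 1) :=
      div_le_self (by positivity) (by exact_mod_cast Nat.one_le_iff_ne_zero.2 (Nat.factorial_ne_zero _))
    have h4 : ξ ^ (β - (r + 1 : ℕ)) ≤ x ^ (β - (r + 1 : ℕ)) :=
      Real.rpow_le_rpow hξ.1.le hξ.2.le (by linarith)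
    calc |D ξ - D 0| * (x ^ (r + 1) / ((r + 1).factorial : ℝ))
        ≤ (L * x ^ (β - (r + 1 : ℕ))) * x ^ (r + 1) := by
          refine mul_le_mul (h1.trans (mul_le_mul_of_nonneg_left h4 hL)) h3 (by positivity)
            (by positivity)
      _ = L * x ^ β := by
          rw [mul_assoc, ← Real.rpow_natCast x (r + 1), ← Real.rpow_add hx0, sub_add_cancel]

/-- The bias of a linear estimator of the slope at `0` of the integrated tail. -/
lemma abs_sum_mul_excess_add_one_le {ν : Measure ℝ} {β L d δ h : ℝ} {ℓ : ℕ} {M : Finset ℕ}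
    {a : ℕ → ℝ} (hβ : 0 < β) (hL : 0 ≤ L) (hd : 0 < d) (hI : Integrable id ν)
    (hν : ν ∈ smoothClass β L (Set.Icc 0 (2 * d))) (hℓ : strictFloor β + 1 ≤ ℓ)
    (ha : IsFeasible M δ ℓ 0 a) (hM : ∀ k ∈ M, (k : ℝ) * δ ∈ Set.Icc 0 (2 * h)) (hhd : h ≤ d) :
    |∑ k ∈ M, a k * excess ν (k * δ) + 1| ≤ (∑ k ∈ M, |a k|) * (L * (2 * h) ^ (β + 1)) := by
  have := hν.1.prob
  set s := strictFloor β with hs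
  obtain ⟨c, hc0, hc⟩ := exists_taylor_approx (f := cdf ν) (by positivity : 0 < 2 * d) hL
    (strictFloor_lt hβ).1 hν.2.1 hν.2.2
  have hc0' : c 0 = 0 := by
    rw [hc0, cdf_eq_real, Measure.real, hν.1.pos, ENNReal.toReal_zero]
  let e : ℝ → ℝ := fun t => ∫ y in (0 : ℝ)..t, (cdf ν y - ∑ i ∈ Finset.range (s + 1), c i * y ^ i)
  have hpi : ∀ t, IntervalIntegrable (fun y => ∑ i ∈ Finset.range (s + 1), c i * y ^ i)
      volume 0 t := fun t => (by fun_prop : Continuous _).intervalIntegrable _ _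
  have hex : ∀ t, 0 ≤ t → excess ν t = excess ν 0 - t
      + ∑ i ∈ Finset.range (s + 1), c i / (i + 1) * t ^ (i + 1) + e t := by
    intro t ht
    rw [excess_eq hν.1 hI ht]
    simp only [e]
    rw [intervalIntegral.integral_sub (monotone_cdf ν).intervalIntegrable (hpi t),
      intervalIntegral.integral_finsetSum fun i _ =>
        (by fun_prop : Continuous fun y : ℝ => c i * y ^ i).intervalIntegrable _ _]
    have : ∀ i, ∫ y in (0 : ℝ)..t, c i * y ^ i = c i / (i + 1) * t ^ (i + 1) := fun i => by
      rw [intervalIntegral.integral_const_mul, integral_pow]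
      simp
      ring
    simp only [this]
    ring
  have he : ∀ t ∈ Set.Icc 0 (2 * h), |e t| ≤ L * (2 * h) ^ (β + 1) := by
    intro t ht
    have h1 : ∀ y ∈ Set.uIoc 0 t, ‖cdf ν y - ∑ i ∈ Finset.range (s + 1), c i * y ^ i‖
        ≤ L * t ^ β := by
      intro y hy
      rw [Set.uIoc_of_le ht.1] at hy
      refine (hc y ⟨hy.1.le, hy.2.trans (ht.2.trans (by linarith))⟩).trans ?_
      exact mul_le_mul_of_nonneg_left (Real.rpow_le_rpow hy.1.le hy.2 hβ.le) hL
    have h2 := intervalIntegral.norm_integral_le_of_norm_le_const h1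
    rw [sub_zero, abs_of_nonneg ht.1] at h2
    refine h2.trans ?_
    have h3 : t ^ β * t = t ^ (β + 1) := by
      rcases ht.1.eq_or_lt with h0 | h0
      · rw [← h0, mul_zero, Real.zero_rpow (by linarith)]
      · rw [Real.rpow_add h0, Real.rpow_one]
    rw [mul_assoc, h3]
    exact mul_le_mul_of_nonneg_left (Real.rpow_le_rpow ht.1 ht.2 (by linarith)) hL
  have hsum : ∑ k ∈ M, a k * excess ν (k * δ) + 1 = ∑ k ∈ M, a k * e (k * δ) := by
    have h1 : ∑ k ∈ M, a k * ((k : ℝ) * δ) = 1 := by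
      have := ha.2 1 (Finset.mem_Icc.2 ⟨le_rfl, by omega⟩)
      simpa using this
    have h2 : ∑ k ∈ M, a k * ∑ i ∈ Finset.range (s + 1), c i / (i + 1) * ((k : ℝ) * δ) ^ (i + 1)
        = 0 := by
      simp_rw [Finset.mul_sum]
      rw [Finset.sum_comm]
      refine Finset.sum_eq_zero fun i hi => ?_
      have h3 := ha.2 (i + 1) (Finset.mem_Icc.2 ⟨by omega, by
        have := Finset.mem_range.1 hi
        omega⟩)
      have h4 : ∑ k ∈ M, a k * (c i / (i + 1) * ((k : ℝ) * δ) ^ (i + 1))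
          = c i / (i + 1) * ∑ k ∈ M, a k * ((k : ℝ) * δ) ^ (i + 1) := by
        rw [Finset.mul_sum]
        exact Finset.sum_congr rfl fun k _ => by ring
      rw [h4, h3]
      -- The constraint of degree 1 has right side 1, not 0, so the linear term must vanish by
      -- itself: its coefficient is G(0) = 0.
      rcases i with _ | i
      · simp [hc0']
      · simp
    have h5 : ∀ k ∈ M, a k * excess ν (k * δ) = a k * excess ν 0 - a k * ((k : ℝ) * δ)
        + a k * ∑ i ∈ Finset.range (s + 1), c i / (i + 1) * ((k : ℝ) * δ) ^ (i + 1)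
        + a k * e (k * δ) := fun k hk => by
      rw [hex _ (hM k hk).1]
      ring
    rw [Finset.sum_congr rfl h5, Finset.sum_add_distrib, Finset.sum_add_distrib,
      Finset.sum_sub_distrib, ← Finset.sum_mul, ha.1, h1, h2]
    ring
  rw [hsum, Finset.sum_mul]
  refine (Finset.abs_sum_le_sum_abs _ _).trans (Finset.sum_le_sum fun k hk => ?_)
  rw [abs_mul]
  exact mul_le_mul_of_nonneg_left (he _ (hM k hk)) (abs_nonneg _)

end MGInf

end

/-! ### The window width and the assembly of the risk bound -/

noncomputable section

namespace MGInf

open scoped ENNReal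

lemma eLpNorm_two_le_sqrt {Ω : Type*} [MeasurableSpace Ω] {P : Measure Ω} {f : Ω → ℝ} {V : ℝ}
    (hf : AEStronglyMeasurable f P) (hi : Integrable (fun ω => f ω ^ 2) P)
    (hV : ∫ ω, f ω ^ 2 ∂P ≤ V) : eLpNorm f 2 P ≤ ENNReal.ofReal (Real.sqrt V) := by
  have hL : MemLp f 2 P := (memLp_two_iff_integrable_sq hf).2 hi
  rw [hL.eLpNorm_eq_integral_rpow_norm two_ne_zero ENNReal.ofNat_ne_top]
  refine ENNReal.ofReal_le_ofReal ?_
  simp only [ENNReal.toReal_ofNat, Real.rpow_two, Real.norm_eq_abs, sq_abs]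
  rw [Real.sqrt_eq_rpow, one_div]
  exact Real.rpow_le_rpow (integral_nonneg fun ω => sq_nonneg _) hV (by norm_num)

lemma hStar_pos {β L K T : ℝ} (hL : 0 < L) (hK : 0 < K) (hT : 0 < T) :
    0 < hStar β L K T := by
  unfold hStar kappaK
  have : 0 < max (Real.sqrt K) 1 := lt_max_of_lt_right one_pos
  positivity

lemma kappaK_pos {K : ℝ} (hK : 0 < K) : 0 < kappaK K :=
  mul_pos hK (lt_max_of_lt_right one_pos)

lemma hStar_rpow {β L K T : ℝ} (hβ : 0 < β) (hL : 0 < L) (hK : 0 < K) (hT : 0 < T) :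
    hStar β L K T ^ (2 * β + 2) = kappaK K / (L ^ 2 * T) := by
  have := kappaK_pos hK
  unfold hStar
  rw [← Real.rpow_mul (by positivity), one_div_mul_cancel (by positivity), Real.rpow_one]

/-- `κ / T = (L h^β)² h²` at `h = h_*`. -/
lemma kappaK_div_eq {β L K T : ℝ} (hβ : 0 < β) (hL : 0 < L) (hK : 0 < K) (hT : 0 < T) :
    kappaK K / T = (L * hStar β L K T ^ β * hStar β L K T) ^ 2 := by
  have hh := hStar_pos (β := β) hL hK hT
  have h1 := hStar_rpow hβ hL hK hT
  have h2 : hStar β L K T ^ (2 * β + 2) = (hStar β L K T ^ β * hStar β L K T) ^ 2 := by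
    rw [← Real.rpow_add_one hh.ne', ← Real.rpow_natCast, ← Real.rpow_mul hh.le]
    congr 1
    push_cast
    ring
  rw [mul_assoc, mul_pow, ← h2, h1]
  field_simp

lemma mul_hStar_rpow {β L K T : ℝ} (hβ : 0 < β) (hL : 0 < L) (hK : 0 < K) (hT : 0 < T) :
    L * hStar β L K T ^ β = L ^ (1 / (β + 1)) * (kappaK K / T) ^ (β / (2 * β + 2)) := by
  have hκ := kappaK_pos hK
  have e1 : kappaK K / (L ^ 2 * T) = kappaK K / T * L ^ (-2 : ℝ) := by
    rw [Real.rpow_neg hL.le, Real.rpow_two]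
    field_simp
  unfold hStar
  rw [e1, ← Real.rpow_mul (by positivity), Real.mul_rpow (by positivity) (by positivity),
    ← Real.rpow_mul hL.le]
  have e2 : 1 / (2 * β + 2) * β = β / (2 * β + 2) := by ring
  have e3 : L * L ^ (-2 * (1 / (2 * β + 2) * β)) = L ^ (1 / (β + 1)) := by
    nth_rewrite 1 [← Real.rpow_one L]
    rw [← Real.rpow_add hL]
    congr 1
    field_simp
    ring
  rw [e2] at e3 ⊢
  rw [← e3]
  ring

lemma hStar_le {β L K T d : ℝ} (hβ : 0 < β) (hL : 0 < L) (hK : 0 < K) (hT : 0 < T) (hd : 0 < d)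
    (h : kappaK K * L ^ (-2 : ℝ) * d ^ (-2 * β - 2) ≤ T) : hStar β L K T ≤ d := by
  rw [← Real.rpow_le_rpow_iff (hStar_pos hL hK hT).le hd.le (by positivity : 0 < 2 * β + 2),
    hStar_rpow hβ hL hK hT, div_le_iff₀ (by positivity)]
  rw [Real.rpow_neg hL.le, Real.rpow_two, show -2 * β - 2 = -(2 * β + 2) by ring,
    Real.rpow_neg hd.le, ← div_eq_mul_inv, ← div_eq_mul_inv, div_div,
    div_le_iff₀ (by positivity)] at h
  linarith

lemma le_hStar {β L K T y : ℝ} (hβ : 0 < β) (hL : 0 < L) (hK : 0 < K) (hT : 0 < T) (hy : 0 < y)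
    (h : T ≤ kappaK K * L ^ (-2 : ℝ) * (1 / y) ^ (2 * β + 2)) : y ≤ hStar β L K T := by
  rw [← Real.rpow_le_rpow_iff hy.le (hStar_pos hL hK hT).le (by positivity : 0 < 2 * β + 2),
    hStar_rpow hβ hL hK hT, le_div_iff₀ (by positivity)]
  rw [Real.rpow_neg hL.le, Real.rpow_two, one_div, Real.inv_rpow hy.le, ← div_eq_mul_inv,
    ← div_eq_mul_inv, div_div, le_div_iff₀ (by positivity)] at h
  linarith

/-- The window width is at most of the order `√K`, provided that `ε = L h^β` or `√K / h` is
bounded from below. -/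
lemma le_mul_sqrt {K T h ε A : ℝ} (hK : 0 < K) (hh : 0 < h) (hA : 1 ≤ A) (hT : 1 ≤ T)
    (hhT : 2 * h < T) (hκ : kappaK K / T = (ε * h) ^ 2)
    (h1 : 1 ≤ A * ε + A * (Real.sqrt K / h)) : h ≤ 2 * A * Real.sqrt K := by
  by_contra! hcon
  set r := Real.sqrt K with hr
  have hr0 : 0 < r := Real.sqrt_pos.2 hK
  have hr2 : K = r ^ 2 := (Real.sq_sqrt hK.le).symm
  have h2 : A * (r / h) < 1 / 2 := by
    rw [← mul_div_assoc, div_lt_iff₀ hh]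
    linarith
  have h3 : 1 / 2 < A * ε := by linarith
  rw [div_eq_iff (by positivity)] at hκ
  have h4 : h ^ 2 * T < 4 * A ^ 2 * kappaK K := by
    have h5 : 1 < 4 * (A * ε) ^ 2 := by nlinarith
    rw [hκ]
    have : 0 < h ^ 2 * T := by positivity
    nlinarith
  have h6 : (2 * A * r) ^ 2 < h ^ 2 := by gcongr
  unfold kappaK at h4
  rw [← hr] at h4
  -- The two branches of √K ∨ 1. For √K ≤ 1, κ = K and T ≥ 1 gives h² < 4A²K. For √K ≥ 1, κ =
  -- K^(3/2) and T > 2h gives 2h³ < 4A²K^(3/2). Both contradict h > 2A√K.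
  rcases le_total r 1 with hr1 | hr1
  · rw [max_eq_right hr1, mul_one, hr2] at h4
    nlinarith [sq_nonneg h]
  · rw [max_eq_left hr1, hr2] at h4
    have h7 : h ^ 2 * T ≥ h ^ 2 * (2 * h) := by gcongr
    have h8 : (2 * A * r) ^ 2 * (2 * (2 * A * r)) ≤ h ^ 2 * (2 * h) := by gcongr
    have h9 : 4 * A ^ 2 * (r ^ 2 * r) ≤ (2 * A * r) ^ 2 * (2 * (2 * A * r)) := by
      have : 0 ≤ A ^ 2 * r ^ 3 := by positivity
      nlinarith
    linarith

lemma mem_of_mem_gridIndices {n k : ℕ} {δ : ℝ} {D : Set ℝ} (hk : k ∈ gridIndices n δ D) :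
    (k : ℝ) * δ ∈ D := by
  simp only [gridIndices, Finset.mem_filter] at hk
  exact hk.2

/-- The variance of the sample means used by the estimator. -/
lemma meanVar_le_mul_div {ν : Measure ℝ} {K : ℝ} (hν : ν ∈ momentClass 2 K) (hK : 0 < K)
    {lam δ h B : ℝ} {n k : ℕ} (hlam : 0 ≤ lam) (hδ : 0 < δ) (hB : 0 ≤ B) (hn : 2 * h < n * δ)
    (hδh : δ ≤ h) (hk : (k : ℝ) * δ ≤ 2 * h) (hkn : k < n) (hhK : h ≤ B * Real.sqrt K) :
    meanVar lam ν δ (n - k) ≤ (4 * B + 4) * (lam * (K / (n * δ))) := by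
  have := hν.1.prob
  have hI := integrable_id_of_momentClass hν hK.le
  have hm : n - k ≠ 0 := by omega
  have he := excess_zero_le_sqrt hν hK.le
  have hr0 : 0 ≤ Real.sqrt K := Real.sqrt_nonneg K
  have hr2 : Real.sqrt K * Real.sqrt K = K := Real.mul_self_sqrt hK.le
  have hh : 0 < h := hδ.trans_le hδh
  have hT : 0 < (n : ℝ) * δ := by linarith
  have hmc : ((n - k : ℕ) : ℝ) = n - k := Nat.cast_sub hkn.le
  -- If 4h ≤ T, at least half of the sample is averaged. Otherwise T ≤ 4h ≤ 4B√K, and the trivial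
  -- bound λ√K is already at most 4BλK/T.
  rcases le_total (4 * h) (n * δ) with h4 | h4
  · refine (meanVar_le_div hν hK.le hlam hδ hm).trans ?_
    rw [mul_left_comm (4 * B + 4)]
    refine mul_le_mul_of_nonneg_left ?_ hlam
    have hm0 : (0 : ℝ) < (n - k : ℕ) := by exact_mod_cast Nat.pos_of_ne_zero hm
    have hmT : n * δ ≤ 2 * ((n - k : ℕ) * δ) := by
      rw [hmc]
      linarith
    calc ((n - k : ℕ) : ℝ)⁻¹ * (excess ν 0 + 2 * (K / δ))
        ≤ ((n - k : ℕ) : ℝ)⁻¹ * (Real.sqrt K + 2 * (K / δ)) := by gcongr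
      _ = (Real.sqrt K * δ + 2 * K) / ((n - k : ℕ) * δ) := by
          field_simp
      _ ≤ (B * K + 2 * K) / ((n - k : ℕ) * δ) := by
          have h5 : Real.sqrt K * δ ≤ B * K := by nlinarith
          exact div_le_div_of_nonneg_right (by linarith) (by positivity)
      _ ≤ (B * K + 2 * K) / (n * δ / 2) := by
          gcongr
          linarith
      _ = (2 * B + 4) * (K / (n * δ)) := by
          field_simp
          ring
      _ ≤ (4 * B + 4) * (K / (n * δ)) := by
          gcongr
          norm_num
  · refine (meanVar_le hlam hI δ hm).trans ?_
    rw [mul_left_comm (4 * B + 4)]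
    refine mul_le_mul_of_nonneg_left (he.trans ?_) hlam
    rw [mul_div_assoc', le_div_iff₀ hT]
    have : n * δ ≤ 4 * (B * Real.sqrt K) := by linarith
    nlinarith

/-- Replacing β by ℓ in the power of 2 keeps the final constant independent of β. -/
lemma rpow_le_two_pow_mul {β h : ℝ} {ℓ : ℕ} (hβ : β ≤ ℓ) (hh : 0 < h) :
    (2 * h) ^ (β + 1) / h ≤ 2 ^ (ℓ + 1) * h ^ β := by
  rw [Real.mul_rpow zero_le_two hh.le, Real.rpow_add_one hh.ne', div_le_iff₀ hh, mul_assoc]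
  refine mul_le_mul_of_nonneg_right ?_ (by positivity)
  rw [← Real.rpow_natCast 2 (ℓ + 1)]
  refine Real.rpow_le_rpow_of_exponent_le one_le_two ?_
  push_cast
  linarith

/-- The root mean squared error as the sum of the stochastic error and of the bias. -/
lemma IsMGInfinity.eLpNorm_rateEstimator_sub_le {Ω : Type*} [MeasurableSpace Ω] {P : Measure Ω}
    [IsProbabilityMeasure P] {lam δ h V A bias : ℝ} {ν : Measure ℝ} [IsProbabilityMeasure ν]
    {τ σ : ℤ → Ω → ℝ} {n ℓ : ℕ} (hq : IsMGInfinity P lam ν τ σ) (hlam : 0 ≤ lam) (hδ : 0 ≤ δ)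
    (hI : Integrable id ν) {M : Finset ℕ} (hM : gridIndices n δ (Set.Icc 0 (2 * h)) = M)
    (hMn : ∀ k ∈ M, k < n) (hA : ∑ k ∈ M, |weights M δ ℓ 0 k| ≤ A)
    (hV : ∀ k ∈ M, 10 * (lam * excess ν 0 + 1) * meanVar lam ν δ (n - k) ≤ V)
    (hb : |lam * (∑ k ∈ M, weights M δ ℓ 0 k * excess ν (k * δ) + 1)| ≤ bias) :
    eLpNorm (fun ω => rateEstimator n δ ℓ h (fun i => queueLength τ σ (i * δ) ω) - lam) 2 P
      ≤ ENNReal.ofReal (A * Real.sqrt V + bias) := by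
  set a := weights M δ ℓ 0 with ha
  set f : ℕ → Ω → ℝ := fun k ω => covHat n (fun i => queueLength τ σ (i * δ) ω) k
    - lam * excess ν (k * δ) with hf
  set b := lam * (∑ k ∈ M, a k * excess ν (k * δ) + 1) with hbdef
  -- Minkowski's inequality is applied to this sum, so no covariances between different R̂_k are
  -- needed.
  have hdecomp : (fun ω => rateEstimator n δ ℓ h (fun i => queueLength τ σ (i * δ) ω) - lam)
      = (∑ k ∈ M, (-a k) • f k) + fun _ => -b := by
    ext ω
    rw [rateEstimator, hM, ← ha, Pi.add_apply, Finset.sum_apply]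
    have e1 : ∀ k, ((-a k) • f k) ω = -(a k * covHat n (fun i => queueLength τ σ (i * δ) ω) k)
        + lam * (a k * excess ν (k * δ)) := fun k => by
      simp only [hf, Pi.smul_apply, smul_eq_mul]
      ring
    rw [Finset.sum_congr rfl fun k _ => e1 k, Finset.sum_add_distrib, Finset.sum_neg_distrib,
      ← Finset.mul_sum, hbdef]
    ring
  have hk : ∀ k ∈ M, AEStronglyMeasurable ((-a k) • f k) P ∧
      eLpNorm ((-a k) • f k) 2 P ≤ ENNReal.ofReal (|a k| * Real.sqrt V) := by
    intro k hk
    obtain ⟨m1, i1, b1⟩ := hq.integral_covHat_sub_sq_le hlam hI hδ (hMn k hk)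
    refine ⟨m1.aestronglyMeasurable.const_smul _, ?_⟩
    refine (eLpNorm_const_smul_le).trans ?_
    rw [ENNReal.ofReal_mul (abs_nonneg _), enorm_neg, Real.enorm_eq_ofReal_abs]
    gcongr
    exact eLpNorm_two_le_sqrt m1.aestronglyMeasurable i1 (b1.trans (hV k hk))
  rw [hdecomp]
  refine (eLpNorm_add_le (Finset.aestronglyMeasurable_sum _ fun k hk' => (hk k hk').1)
    aestronglyMeasurable_const one_le_two).trans ?_
  have h1 : eLpNorm (∑ k ∈ M, (-a k) • f k) 2 P ≤ ENNReal.ofReal (A * Real.sqrt V) := by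
    refine (eLpNorm_sum_le (fun k hk' => (hk k hk').1) one_le_two).trans ?_
    refine (Finset.sum_le_sum fun k hk' => (hk k hk').2).trans ?_
    rw [← ENNReal.ofReal_sum_of_nonneg fun _ _ => by positivity, ← Finset.sum_mul]
    exact ENNReal.ofReal_le_ofReal (mul_le_mul_of_nonneg_right hA (Real.sqrt_nonneg _))
  have h2 : eLpNorm (fun _ : Ω => -b) 2 P ≤ ENNReal.ofReal bias := by
    rw [eLpNorm_const _ two_ne_zero (IsProbabilityMeasure.ne_zero P)]
    simp only [measure_univ, ENNReal.one_rpow, mul_one, enorm_neg, Real.enorm_eq_ofReal_abs]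
    exact ENNReal.ofReal_le_ofReal hb
  have hA0 : 0 ≤ A := le_trans (Finset.sum_nonneg fun _ _ => abs_nonneg _) hA
  rw [ENNReal.ofReal_add (by positivity) ((abs_nonneg _).trans hb)]
  exact add_le_add h1 h2

end MGInf

end

theorem theorem2 (ℓ : ℕ) :
    ∃ C : ℝ, 0 < C ∧
      ∀ (β L d K lam δ T : ℝ) (n : ℕ),
        0 < β → 0 < L → 0 < d → 0 < K → 0 < lam → 0 < δ → T = n * δ →
        MGInf.strictFloor β + 1 ≤ ℓ →
        1 ≤ T →
        2 * MGInf.hStar β L K T < T →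
        MGInf.kappaK K * L ^ (-2 : ℝ) * d ^ (-2 * β - 2) ≤ T →
        T ≤ MGInf.kappaK K * L ^ (-2 : ℝ) * (2 / ((ℓ + 2) * δ)) ^ (2 * β + 2) →
        ∀ ν ∈ MGInf.serviceClass β L (Set.Icc 0 (2 * d)) K,
        ∀ {Ω : Type*} [MeasurableSpace Ω] (P : MeasureTheory.Measure Ω)
          [MeasureTheory.IsProbabilityMeasure P] (τ σ : ℤ → Ω → ℝ),
          MGInf.IsMGInfinity P lam ν τ σ →
          MeasureTheory.eLpNorm
              (fun ω => MGInf.rateEstimator n δ ℓ (MGInf.hStar β L K T)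
                (fun i => MGInf.queueLength τ σ (i * δ) ω) - lam) 2 P
            ≤ ENNReal.ofReal
                (C * L ^ (1 / (β + 1)) * (lam ^ 2 + lam) ^ (1 / 2 : ℝ)
                  * (MGInf.kappaK K / T) ^ (β / (2 * β + 2))) := by
  open MGInf in
  obtain ⟨C₀, hC₀, hw⟩ := exists_sum_abs_weights_le ℓ
  -- The product is the constant of the bias; the added 1 gives the bound 1 ≤ A required by
  -- `le_mul_sqrt`, whose conclusion dictates B = 2A.
  set A : ℝ := C₀ * 2 ^ (ℓ + 1) + 1 with hA
  set B : ℝ := 2 * A with hB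
  have hpow : (1 : ℝ) ≤ 2 ^ (ℓ + 1) := one_le_pow₀ one_le_two
  have hC₀A : C₀ ≤ A := by nlinarith
  have hA1 : 1 ≤ A := by
    have : 0 ≤ C₀ * 2 ^ (ℓ + 1) := by positivity
    linarith
  refine ⟨C₀ * Real.sqrt (10 * (4 * B + 4)) + A, by positivity, ?_⟩
  intro β L d K lam δ T n hβ hL hd hK hlam hδ hT hℓ hT1 hhT hlow hup ν hν Ω _ P _ τ σ hq
  have := hν.1.1.prob
  have hT0 : 0 < T := by linarith
  have hκ := kappaK_pos hK
  set h := hStar β L K T with hh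
  have hh0 : 0 < h := hStar_pos hL hK hT0
  have hhd : h ≤ d := hStar_le hβ hL hK hT0 hd hlow
  -- The upper bound on T says precisely that [0, 2h] holds at least ℓ + 2 positive grid points.
  have hyh : (ℓ + 2) * δ / 2 ≤ h :=
    le_hStar hβ hL hK hT0 (by positivity) (by rwa [one_div_div])
  have hδh : δ ≤ h := by nlinarith [(Nat.cast_nonneg ℓ : (0 : ℝ) ≤ ℓ)]
  have hI := integrable_id_of_momentClass hν.2 hK.le
  have hhn : 2 * h < n * δ := by rwa [← hT]
  obtain ⟨hfeas, hsum⟩ := hw n δ h hδ (by linarith) hhn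
  set M := gridIndices n δ (Set.Icc 0 (2 * h)) with hM
  have hMmem : ∀ k ∈ M, (k : ℝ) * δ ∈ Set.Icc 0 (2 * h) := fun k hk =>
    mem_of_mem_gridIndices hk
  have hMn : ∀ k ∈ M, k < n := fun k hk => by
    have h1 : (k : ℝ) * δ < n * δ := (hMmem k hk).2.trans_lt hhn
    exact_mod_cast lt_of_mul_lt_mul_right h1 hδ.le
  set a := weights M δ ℓ 0 with ha
  set ε := L * h ^ β with hε
  have hε0 : 0 < ε := by positivity
  have hκε : kappaK K / T = (ε * h) ^ 2 := kappaK_div_eq hβ hL hK hT0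
  have hβℓ : β ≤ ℓ := by
    have h1 := (strictFloor_lt hβ).2
    have h2 : ((strictFloor β + 1 : ℕ) : ℝ) ≤ ℓ := by exact_mod_cast hℓ
    push_cast at h2
    linarith
  have hbias : |∑ k ∈ M, a k * excess ν (k * δ) + 1| ≤ A * ε := by
    refine (abs_sum_mul_excess_add_one_le hβ hL.le hd hI hν.1 hℓ hfeas hMmem hhd).trans ?_
    calc (∑ k ∈ M, |a k|) * (L * (2 * h) ^ (β + 1))
        ≤ C₀ / h * (L * (2 * h) ^ (β + 1)) := by gcongr
      _ = C₀ * L * ((2 * h) ^ (β + 1) / h) := by ring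
      _ ≤ C₀ * L * (2 ^ (ℓ + 1) * h ^ β) := by
          gcongr
          exact rpow_le_two_pow_mul hβℓ hh0
      _ = (A - 1) * ε := by
          rw [hA, hε]
          ring
      _ ≤ A * ε := by nlinarith
  have hsqrt := excess_zero_le_sqrt hν.2 hK.le
  -- Write 1 = (Σ a_k H(kδ) + 1) - Σ a_k H(kδ): the bias bound controls the first term, H ≤ √K and
  -- Σ|a_k| ≤ C₀/h the second.
  have hone : 1 ≤ A * ε + A * (Real.sqrt K / h) := by
    have h1 : |∑ k ∈ M, a k * excess ν (k * δ)| ≤ A * (Real.sqrt K / h) := by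
      calc |∑ k ∈ M, a k * excess ν (k * δ)| ≤ ∑ k ∈ M, |a k| * Real.sqrt K := by
            refine (Finset.abs_sum_le_sum_abs _ _).trans (Finset.sum_le_sum fun k hk => ?_)
            rw [abs_mul, abs_of_nonneg (excess_nonneg _)]
            exact mul_le_mul_of_nonneg_left ((excess_anti hI (hMmem k hk).1).trans hsqrt)
              (abs_nonneg _)
        _ ≤ C₀ / h * Real.sqrt K := by
            rw [← Finset.sum_mul]
            gcongr
        _ = C₀ * (Real.sqrt K / h) := by ring
        _ ≤ A * (Real.sqrt K / h) := by gcongr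
    have h2 := abs_le.1 h1
    have h3 := abs_le.1 hbias
    linarith
  have hhK : h ≤ B * Real.sqrt K := le_mul_sqrt hK hh0 hA1 hT1 hhT hκε hone
  have hV : ∀ k ∈ M, 10 * (lam * excess ν 0 + 1) * meanVar lam ν δ (n - k)
      ≤ 10 * (4 * B + 4) * (lam ^ 2 + lam) * (ε * h) ^ 2 := by
    intro k hk
    have h1 := meanVar_le_mul_div hν.2 hK hlam.le hδ (by positivity) hhn hδh (hMmem k hk).2
      (hMn k hk) hhK
    rw [← hT] at h1
    -- This factor, multiplied by the K of the variance bound, produces κ.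
    have h2 : lam * excess ν 0 + 1 ≤ (lam + 1) * max (Real.sqrt K) 1 := by
      have h3 := le_max_left (Real.sqrt K) 1
      have h4 := le_max_right (Real.sqrt K) 1
      have h5 := mul_le_mul_of_nonneg_left (hsqrt.trans h3) hlam.le
      linarith
    calc 10 * (lam * excess ν 0 + 1) * meanVar lam ν δ (n - k)
        ≤ 10 * ((lam + 1) * max (Real.sqrt K) 1) * ((4 * B + 4) * (lam * (K / T))) := by
          refine mul_le_mul (by linarith) h1 (meanVar_nonneg hlam.le _ _) ?_
          have : 0 < max (Real.sqrt K) 1 := lt_max_of_lt_right one_pos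
          positivity
      _ = 10 * (4 * B + 4) * (lam ^ 2 + lam) * (kappaK K / T) := by
          rw [kappaK]
          ring
      _ = _ := by rw [hκε]
  have hfinal := hq.eLpNorm_rateEstimator_sub_le hlam.le hδ.le hI hM.symm hMn hsum hV
    (bias := lam * (A * ε)) (by
      rw [abs_mul, abs_of_pos hlam]
      exact mul_le_mul_of_nonneg_left hbias hlam.le)
  refine hfinal.trans (ENNReal.ofReal_le_ofReal ?_)
  have hrate : L ^ (1 / (β + 1)) * (kappaK K / T) ^ (β / (2 * β + 2)) = ε :=
    (mul_hStar_rpow hβ hL hK hT0).symm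
  rw [← Real.sqrt_eq_rpow]
  set S := Real.sqrt (lam ^ 2 + lam) with hS
  -- The bias carries λ, the stochastic error (λ² + λ)^(1/2); the former is absorbed.
  have hlamS : lam ≤ S := Real.le_sqrt_of_sq_le (by linarith)
  have e1 : Real.sqrt (10 * (4 * B + 4) * (lam ^ 2 + lam) * (ε * h) ^ 2)
      = Real.sqrt (10 * (4 * B + 4)) * S * (ε * h) := by
    rw [Real.sqrt_mul (by positivity), Real.sqrt_mul (by positivity), Real.sqrt_sq (by positivity)]
  calc C₀ / h * Real.sqrt (10 * (4 * B + 4) * (lam ^ 2 + lam) * (ε * h) ^ 2) + lam * (A * ε)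
      = C₀ * Real.sqrt (10 * (4 * B + 4)) * S * ε + lam * (A * ε) := by
        rw [e1]
        field_simp
    _ ≤ C₀ * Real.sqrt (10 * (4 * B + 4)) * S * ε + S * (A * ε) := by gcongr
    _ = (C₀ * Real.sqrt (10 * (4 * B + 4)) + A) * S * ε := by ring
    _ = _ := by
        rw [← hrate]
        ring
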